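/- **Theorem 3.** A *timed automaton* has finitely many locations, finitely many clocks with values in $\mathbb R_{\ge 0}$, finitely many edges (each with a source, a guard, a set of clocks to be reset and a target), and an invariant for every location; guards and invariants are finite conjunctions of atoms $x\bowtie c$ with a clock $x$, $c\in\mathbb Z_{\ge 0}$ and ${\bowtie}\in\{<,\le,=,\ge,>\}$. A state $s=(\ell,\nu)$ is a location with a clock valuation that satisfies its invariant. A transition $s\xrightarrow{t,e}s'$ lets $t\ge 0$ time units pass, during which the invariant of $\ell$ holds, and then takes an edge $e$ from $\ell$ whose guard holds, resets its clocks and leads to a state $s'$. $I(s)$ is the set of all $t$ such that $s\xrightarrow{t,e}s'$ for some $e,s'$. A *stochastic timed game* (STG, $2\frac12$-player) is a timed automaton whose locations are partitioned into those of Player $\Box$, of Player $\Diamond$ and of the stochastic player, with positive integer weights on the edges leaving stochastic locations and, for every state $s$ of a stochastic location, a probability measure $\mu(s)$ on $I(s)$, equivalent to Lebesgue measure on $I(s)$ if $I(s)$ has positive Lebesgue measure. At such a state a delay $t$ is drawn from $\mu(s)$, and then one of the edges enabled after the delay is drawn with probability proportional to its weight. A strategy of Player $\Box$ (of Player $\Diamond$)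 is deterministic and maps every finite run that ends in one of the player's locations to a pair $(t,e)$ that is possible there, such that, for a fixed first state and a fixed sequence of edges, the choice depends measurably on the delays of the run. A pair of strategies $\Lambda=(\lambda_\Diamond,\lambda_\Box)$ and an initial state $s_0$ determine a probability measure $\mathcal P_\Lambda$ on infinite runs from $s_0$. The *time-bounded quantitative reachability problem* is: given an STG, a set $T$ of locations, an initial state $s_0$ with rational clock values, a rational time bound $\Delta\ge0$ and a threshold $\bowtie p$ with ${\bowtie}\in\{<,\le,=,\ge,>\}$ and $p\in\mathbb Q$, $0<p<1$, decide whether Player $\Diamond$ has a strategy $\lambda_\Diamond$ such that for every strategy $\lambda_\Box$ of Player $\Box$ $$\mathcal P_\Lambda(\{\rho \mid \rho \text{ visits } T \text{ within } \Delta \text{ time units}\})\bowtie p .$$ For every $n\ge 5$ this problem is undecidable for STGs with $n$ clocks. It is undecidable even for the fixed time bound $\Delta=5$ and for non-blocking STGs (every state has a transition) in which, for every state $s$ of a stochastic location, $I(s)$ is bounded and $\mu(s)$ is the uniform distribution on $I(s)$: no algorithm answers correctly on all of these inputs. -/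

import Mathlib

open MeasureTheory ProbabilityTheory
open scoped ENNReal

noncomputable section

namespace StochasticTimedGame

/-! Clock constraints, valuations and timed automata -/

/-- The comparison operators `<`, `≤`, `=`, `≥`, `>`. -/
inductive Cmp where
  | lt | le | eq | ge | gt

/-- The relation on the reals denoted by a comparison operator. -/
def Cmp.Holds : Cmp → ℝ → ℝ → Prop
  | .lt, a, b => a < b
  | .le, a, b => a ≤ b
  | .eq, a, b => a = b
  | .ge, a, b => a ≥ b
  | .gt, a, b => a > b

/-- A clock constraint over `n` clocks: a finite conjunction of atoms `x ⋈ c` with `c : ℕ`. -/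
abbrev Constraint (n : ℕ) := List (Fin n × Cmp × ℕ)

/-- A valuation satisfies a clock constraint. -/
def Sat {n : ℕ} (ν : Fin n → ℝ) (g : Constraint n) : Prop :=
  ∀ a ∈ g, a.2.1.Holds (ν a.1) (a.2.2 : ℝ)

/-- A location together with a clock valuation. It is a state of an automaton only if
`TimedAutomaton.IsState` holds. -/
abbrev State (m n : ℕ) := Fin m × (Fin n → ℝ)

/-- A pair (delay, edge). -/
abbrev Step (k : ℕ) := ℝ × Fin k

/-- The state `s + t`: all clocks advance by `t`. -/
def State.delay {m n : ℕ} (s : State m n) (t : ℝ) : State m n := (s.1, fun x => s.2 x + t)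

/-- A timed automaton with `m` locations, `n` clocks and `k` edges. -/
structure TimedAutomaton (m n k : ℕ) where
  src : Fin k → Fin m
  guard : Fin k → Constraint n
  reset : Fin k → Finset (Fin n)
  tgt : Fin k → Fin m
  inv : Fin m → Constraint n

namespace TimedAutomaton

variable {m n k : ℕ} (A : TimedAutomaton m n k)

/-- Clock values are nonnegative and satisfy the invariant of the location. -/
def IsState (s : State m n) : Prop := (∀ x, 0 ≤ s.2 x) ∧ Sat s.2 (A.inv s.1)

/-- The pair reached from `s` by letting `a.1` time units pass and then taking the edge `a.2`. -/
def succ (s : State m n) (a : Step k) : State m n :=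
  (A.tgt a.2, fun x => if x ∈ A.reset a.2 then 0 else s.2 x + a.1)

/-- The transition `s →(t,e) s'` exists, where `a = (t, e)`; then `s' = A.succ s a`. -/
def Trans (s : State m n) (a : Step k) : Prop :=
  A.IsState s ∧ A.src a.2 = s.1 ∧ 0 ≤ a.1 ∧
    (∀ t ∈ Set.Icc 0 a.1, Sat (s.delay t).2 (A.inv s.1)) ∧
    Sat (s.delay a.1).2 (A.guard a.2) ∧ A.IsState (A.succ s a)

/-- The edge `e` is enabled from `s`. -/
def Enabled (s : State m n) (e : Fin k) : Prop := A.Trans s (0, e)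

/-- The set `I(s, e)` of the delays after which the edge `e` can be taken. -/
def delaysVia (s : State m n) (e : Fin k) : Set ℝ := {t | A.Trans s (t, e)}

/-- The set `I(s)` of all possible delays. -/
def delays (s : State m n) : Set ℝ := ⋃ e, A.delaysVia s e

/-- Every state has a possible transition. -/
def NonBlocking : Prop := ∀ s, A.IsState s → (A.delays s).Nonempty

/-- The state reached from `s` after the finite sequence `h` of steps. -/
def stateAfter (s : State m n) : (j : ℕ) → (Fin j → Step k) → State m n
  | 0, _ => s
  | j + 1, h => A.succ (stateAfter s j (Fin.init h)) (h (Fin.last j))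

/-- The sequence `h` of steps is a finite run from the state `s`. -/
def IsRun (s : State m n) : (j : ℕ) → (Fin j → Step k) → Prop
  | 0, _ => A.IsState s
  | j + 1, h => IsRun s j (Fin.init h) ∧
      A.Trans (A.stateAfter s j (Fin.init h)) (h (Fin.last j))

end TimedAutomaton

/-! Stochastic timed games -/

/-- Who controls a location: Player `◇`, Player `□`, or the stochastic player. -/
inductive Owner where
  | diamond | box | stochastic
  deriving DecidableEq

/-- A stochastic timed game. The measures `μ s` matter only at states `s` of stochastic locations;
elsewhere `μ s` has the fixed value `dirac 0`. As usual `μ` is measurable in `s`. Only the weights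
of the edges that leave stochastic locations are used. -/
structure Game (m n k : ℕ) extends TimedAutomaton m n k where
  owner : Fin m → Owner
  weight : Fin k → ℕ
  μ : Kernel (State m n) ℝ
  markov : IsMarkovKernel μ
  weight_pos : ∀ e, owner (src e) = .stochastic → 0 < weight e
  μ_delays : ∀ s, toTimedAutomaton.IsState s → owner s.1 = .stochastic →
    μ s (toTimedAutomaton.delays s) = 1
  μ_equiv : ∀ s, toTimedAutomaton.IsState s → owner s.1 = .stochastic →
    0 < volume (toTimedAutomaton.delays s) →
    ∀ B ⊆ toTimedAutomaton.delays s, MeasurableSet B → (volume B = 0 ↔ μ s B = 0)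
  μ_default : ∀ s, ¬ (toTimedAutomaton.IsState s ∧ owner s.1 = .stochastic) →
    μ s = Measure.dirac 0

namespace Game

variable {m n k : ℕ} (G : Game m n k)

instance : IsMarkovKernel G.μ := G.markov

/-- Uniform distributions over delays: each `I(s)` is bounded and `μ s` is the uniform
distribution on it (normalized Lebesgue measure, or, for a Lebesgue-null and hence finite `I(s)`,
normalized counting measure). -/
def HasUniformDelays : Prop :=
  ∀ s, G.IsState s → G.owner s.1 = .stochastic →
    Bornology.IsBounded (G.delays s) ∧
    (volume (G.delays s) ≠ 0 → G.μ s = volume[|G.delays s]) ∧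
    (volume (G.delays s) = 0 → G.μ s = uniformOn (G.delays s))

/-- A deterministic strategy of the player `p`: it maps a finite run, given by its first state and
its steps, to a step; it has to be a legal one if the run ends in a location of `p`. For every
first state and sequence of edges the chosen step depends measurably on the delays. -/
structure Strategy (p : Owner) where
  move : State m n → (j : ℕ) → (Fin j → Step k) → Step k
  legal : ∀ s j h, G.IsRun s j h → G.owner (G.stateAfter s j h).1 = p →
    G.Trans (G.stateAfter s j h) (move s j h)
  measurable_delays : ∀ s j (e : Fin j → Fin k),
    Measurable fun t : Fin j → ℝ => move s j fun i => (t i, e i)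

/-! Measurability of the ingredients of the run measure -/

theorem measurableSet_sat (g : Constraint n) : MeasurableSet {ν : Fin n → ℝ | Sat ν g} := by
  have h : {ν : Fin n → ℝ | Sat ν g} = ⋂ a ∈ {a | a ∈ g}, {ν | a.2.1.Holds (ν a.1) (a.2.2 : ℝ)} := by
    ext ν; simp [Sat]
  rw [h]
  refine MeasurableSet.biInter (List.finite_toSet g).countable fun a _ => ?_
  rcases a with ⟨x, c, q⟩
  cases c
  · exact measurableSet_lt (measurable_pi_apply x) measurable_const
  · exact measurableSet_le (measurable_pi_apply x) measurable_const
  · exact measurableSet_eq_fun (measurable_pi_apply x) measurable_const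
  · exact measurableSet_le measurable_const (measurable_pi_apply x)
  · exact measurableSet_lt measurable_const (measurable_pi_apply x)

theorem measurable_delay :
    Measurable fun q : State m n × ℝ => q.1.delay q.2 := by
  unfold State.delay
  fun_prop

theorem measurable_succ (A : TimedAutomaton m n k) :
    Measurable fun q : State m n × Step k => A.succ q.1 q.2 := by
  refine Measurable.prodMk ((measurable_of_finite A.tgt).comp measurable_snd.snd) ?_
  refine measurable_pi_lambda _ fun x => Measurable.ite ?_ measurable_const (by fun_prop)
  exact measurable_snd.snd (Set.toFinite {e | x ∈ A.reset e}).measurableSet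

theorem measurable_stateAfter (A : TimedAutomaton m n k) (s : State m n) (j : ℕ) :
    Measurable (A.stateAfter s j) := by
  induction j with
  | zero => exact measurable_const
  | succ j ih =>
    exact (measurable_succ A).comp (Measurable.prodMk
      (ih.comp (measurable_pi_lambda _ fun i => measurable_pi_apply i.castSucc))
      (measurable_pi_apply (Fin.last j)))

theorem measurableSet_isState (A : TimedAutomaton m n k) :
    MeasurableSet {s | A.IsState s} := by
  refine MeasurableSet.inter ?_ ?_
  · have : {s : State m n | ∀ x, 0 ≤ s.2 x} = ⋂ x, {s | 0 ≤ s.2 x} := by ext; simp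
    show MeasurableSet {s : State m n | ∀ x, 0 ≤ s.2 x}
    rw [this]
    exact MeasurableSet.iInter fun x => measurableSet_le measurable_const (by fun_prop)
  · have : {s : State m n | Sat s.2 (A.inv s.1)}
        = ⋃ l, (Prod.fst ⁻¹' {l} ∩ Prod.snd ⁻¹' {ν | Sat ν (A.inv l)}) := by ext; simp
    show MeasurableSet {s : State m n | Sat s.2 (A.inv s.1)}
    rw [this]
    exact MeasurableSet.iUnion fun l => (measurable_fst (measurableSet_singleton l)).inter
      (measurable_snd (measurableSet_sat _))

theorem measurableSet_enabled (A : TimedAutomaton m n k) (e : Fin k) :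
    MeasurableSet {s | A.Enabled s e} := by
  have : {s | A.Enabled s e} = {s | A.IsState s} ∩ (Prod.fst ⁻¹' {A.src e} ∩
      (Prod.snd ⁻¹' {ν | Sat ν (A.guard e)} ∩ (fun s => A.succ s (0, e)) ⁻¹' {s | A.IsState s})) := by
    ext s
    simp only [TimedAutomaton.Enabled, TimedAutomaton.Trans, State.delay, Set.mem_ofPred_eq,
      Set.mem_inter_iff, Set.mem_preimage, Set.mem_singleton_iff, Set.Icc_self, forall_eq, add_zero,
      le_refl, true_and]
    constructor
    · rintro ⟨h1, h2, -, h3, h4⟩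
      exact ⟨h1, h2.symm, h3, h4⟩
    · rintro ⟨h1, h2, h3, h4⟩
      exact ⟨h1, h2.symm, h1.2, h3, h4⟩
  rw [this]
  exact (measurableSet_isState A).inter ((measurable_fst (measurableSet_singleton _)).inter
    ((measurable_snd (measurableSet_sat _)).inter
      (((measurable_succ A).comp (measurable_id.prodMk measurable_const))
        (measurableSet_isState A))))

variable {G} in
theorem Strategy.measurable {p : Owner} (σ : G.Strategy p) (s : State m n) (j : ℕ) :
    Measurable (σ.move s j) := by
  have h : Measurable fun q : (Fin j → ℝ) × (Fin j → Fin k) => σ.move s j fun i => (q.1 i, q.2 i) :=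
    measurable_from_prod_countable_left fun e => σ.measurable_delays s j e
  exact h.comp (f := fun q : Fin j → Step k => (fun i => (q i).1, fun i => (q i).2)) (by fun_prop)

/-! The probability measure of a strategy profile -/

open Classical in
/-- The weight of `e` if it is enabled in `s`, and `0` otherwise. -/
def enabledWeight (s : State m n) (e : Fin k) : ℕ := if G.Enabled s e then G.weight e else 0

/-- The sum of the weights of the edges that are enabled in `s`. -/
def totalWeight (s : State m n) : ℕ := ∑ e, G.enabledWeight s e

/-- The random choice of an edge in `s`: an enabled edge `e` has the probability
`weight e / ∑ {weight e' | e' enabled in s}`. If the sum is zero, the value is `dirac d`; in a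
non-blocking game this concerns only sets of runs of probability zero. -/
def edgeLaw (s : State m n) (d : Fin k) : Measure (Fin k) :=
  if G.totalWeight s = 0 then Measure.dirac d
  else ∑ e, ((G.enabledWeight s e : ℝ≥0∞) / (G.totalWeight s : ℝ≥0∞)) • Measure.dirac e

instance (s : State m n) (d : Fin k) : IsProbabilityMeasure (G.edgeLaw s d) := by
  unfold edgeLaw
  split_ifs with h
  · infer_instance
  · constructor
    have h' : (G.totalWeight s : ℝ≥0∞) ≠ 0 := by exact_mod_cast h
    simp only [Measure.coe_finsetSum, Measure.coe_smul, Finset.sum_apply, Pi.smul_apply,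
      measure_univ, smul_eq_mul, mul_one, ENNReal.div_eq_inv_mul]
    rw [← Finset.mul_sum, ← Nat.cast_sum]
    exact ENNReal.inv_mul_cancel h' (ENNReal.natCast_ne_top _)

theorem measurable_enabledWeight (e : Fin k) :
    Measurable fun s : State m n => G.enabledWeight s e :=
  Measurable.ite (measurableSet_enabled _ e) measurable_const measurable_const

theorem measurable_totalWeight : Measurable G.totalWeight :=
  Finset.measurable_sum _ fun e _ => G.measurable_enabledWeight e

theorem measurable_edgeLaw :
    Measurable fun q : State m n × Fin k => G.edgeLaw q.1 q.2 := by
  refine Measure.measurable_of_measurable_coe _ fun B hB => ?_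
  have : (fun q : State m n × Fin k => G.edgeLaw q.1 q.2 B) = fun q =>
      if G.totalWeight q.1 = 0 then Measure.dirac q.2 B
      else ∑ e, ((G.enabledWeight q.1 e : ℝ≥0∞) / (G.totalWeight q.1 : ℝ≥0∞))
        * Measure.dirac e B := by
    funext q
    unfold edgeLaw
    split_ifs <;> simp
  rw [this]
  have hW : Measurable fun q : State m n × Fin k => G.totalWeight q.1 :=
    G.measurable_totalWeight.comp measurable_fst
  refine Measurable.ite (hW (measurableSet_singleton 0)) ?_ ?_
  · exact ((Measure.measurable_coe hB).comp Measure.measurable_dirac).comp measurable_snd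
  · refine Finset.measurable_sum _ fun e _ => Measurable.mul_const (Measurable.div ?_ ?_) _
    · exact (measurable_from_top (f := fun w : ℕ => (w : ℝ≥0∞))).comp
        ((G.measurable_enabledWeight e).comp measurable_fst)
    · exact (measurable_from_top (f := fun w : ℕ => (w : ℝ≥0∞))).comp hW

variable {G} (s : State m n) (σ : G.Strategy .diamond) (τ : G.Strategy .box)

/-- The law of the chosen edge, given the steps made so far and the random delay. -/
def edgeKernel (j : ℕ) : Kernel ((Fin j → Step k) × ℝ) (Fin k) where
  toFun q := G.edgeLaw ((G.stateAfter s j q.1).delay q.2) (σ.move s j q.1).2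
  measurable' := G.measurable_edgeLaw.comp (Measurable.prodMk
    (measurable_delay.comp (Measurable.prodMk
      ((measurable_stateAfter _ s j).comp measurable_fst) measurable_snd))
    ((σ.measurable s j).comp measurable_fst).snd)

instance (j : ℕ) : IsMarkovKernel (edgeKernel s σ j) :=
  ⟨fun q => inferInstanceAs (IsProbabilityMeasure
    (G.edgeLaw ((G.stateAfter s j q.1).delay q.2) (σ.move s j q.1).2))⟩

/-- The law of a step of the stochastic player: first a delay according to `μ`, then an edge. -/
def stochasticKernel (j : ℕ) : Kernel (Fin j → Step k) (Step k) :=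
  (G.μ.comap (G.stateAfter s j) (measurable_stateAfter _ s j)) ⊗ₖ (edgeKernel s σ j)

instance (j : ℕ) : IsMarkovKernel (stochasticKernel s σ j) := by
  unfold stochasticKernel; infer_instance

theorem measurableSet_owner (p : Owner) (j : ℕ) :
    MeasurableSet {h : Fin j → Step k | G.owner (G.stateAfter s j h).1 = p} :=
  (measurable_stateAfter _ s j).fst (Set.toFinite {l | G.owner l = p}).measurableSet

/-- The law of the next step, given the `j` steps made so far from the first state `s`, when the
players use the strategies `σ` and `τ`. -/
def nextKernel (j : ℕ) : Kernel (Fin j → Step k) (Step k) :=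
  Kernel.piecewise (measurableSet_owner (G := G) s .diamond j)
    (Kernel.deterministic (σ.move s j) (σ.measurable s j))
    (Kernel.piecewise (measurableSet_owner (G := G) s .box j)
      (Kernel.deterministic (τ.move s j) (τ.measurable s j))
      (stochasticKernel s σ j))

instance (j : ℕ) : IsMarkovKernel (nextKernel s σ τ j) := by
  unfold nextKernel; infer_instance

/-- The law of step number `j + 1`, given the steps number `0, …, j`. -/
def historyKernel (j : ℕ) : Kernel ((_ : Finset.Iic j) → Step k) (Step k) :=
  (nextKernel s σ τ (j + 1)).comap
    (fun h i => h ⟨i, Finset.mem_Iic.2 (Nat.lt_succ_iff.1 i.2)⟩)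
    (measurable_pi_lambda _ fun _ => measurable_pi_apply _)

instance (j : ℕ) : IsMarkovKernel (historyKernel s σ τ j) := by
  unfold historyKernel; infer_instance

/-- The probability measure of the strategy profile `(σ, τ)` on the infinite runs from `s`; a run is
represented by the sequence of its steps. -/
def runMeasure : Measure (ℕ → Step k) :=
  Kernel.trajMeasure (X := fun _ => Step k) (nextKernel s σ τ 0 Fin.elim0) (historyKernel s σ τ)

/-! Time-bounded reachability -/

/-- The run from `s` with the steps `ω` is in a location of `T` at some moment when at most `Δ` time
units have passed. -/
def VisitsWithin (G : Game m n k) (s : State m n) (T : Set (Fin m)) (Δ : ℝ) (ω : ℕ → Step k) : Prop :=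
  ∃ j : ℕ, (G.stateAfter s j fun i => ω i).1 ∈ T ∧ ∑ i ∈ Finset.range j, (ω i).1 ≤ Δ

/-- Player `◇` has a strategy such that, for every strategy of Player `□`, the probability to visit
`T` from `s` within `Δ` time units is `⋈ p`. -/
def DiamondWins (G : Game m n k) (s : State m n) (T : Set (Fin m)) (Δ : ℝ) (c : Cmp) (p : ℝ) : Prop :=
  ∃ σ : G.Strategy .diamond, ∀ τ : G.Strategy .box,
    c.Holds ((runMeasure s σ τ).real {ω | G.VisitsWithin s T Δ ω}) p

end Game

/-! Finite descriptions of the inputs of the decision problem -/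

/-- Codes of comparison operators. -/
def cmpEquiv : Cmp ≃ Fin 5 where
  toFun | .lt => 0 | .le => 1 | .eq => 2 | .ge => 3 | .gt => 4
  invFun | 0 => .lt | 1 => .le | 2 => .eq | 3 => .ge | 4 => .gt
  left_inv c := by cases c <;> rfl
  right_inv i := by fin_cases i <;> rfl

instance : Primcodable Cmp := Primcodable.ofEquiv (Fin 5) cmpEquiv

/-- Codes of owners. -/
def ownerEquiv : Owner ≃ Fin 3 where
  toFun | .diamond => 0 | .box => 1 | .stochastic => 2
  invFun | 0 => .diamond | 1 => .box | 2 => .stochastic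
  left_inv c := by cases c <;> rfl
  right_inv i := by fin_cases i <;> rfl

instance : Primcodable Owner := Primcodable.ofEquiv (Fin 3) ownerEquiv

/-- The nonnegative rational number `q.1 / (q.2 + 1)`. -/
def ratVal (q : ℕ × ℕ) : ℝ := (q.1 : ℝ) / ((q.2 : ℝ) + 1)

/-- An edge over `n` clocks; locations are given by their numbers. -/
structure EdgeCode (n : ℕ) where
  src : ℕ
  guard : Constraint n
  reset : List (Fin n)
  tgt : ℕ
  weight : ℕ

/-- Codes of edges. -/
def edgeCodeEquiv (n : ℕ) : EdgeCode n ≃ ℕ × Constraint n × List (Fin n) × ℕ × ℕ where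
  toFun e := (e.src, e.guard, e.reset, e.tgt, e.weight)
  invFun q := ⟨q.1, q.2.1, q.2.2.1, q.2.2.2.1, q.2.2.2.2⟩
  left_inv _ := rfl
  right_inv _ := rfl

instance (n : ℕ) : Primcodable (EdgeCode n) :=
  Primcodable.ofEquiv (ℕ × Constraint n × List (Fin n) × ℕ × ℕ) (edgeCodeEquiv n)

/-- An input of the time-bounded quantitative reachability problem for games with `n` clocks and
uniform distributions over delays: the locations with owners and invariants, the edges, the target
locations, the initial state, the time bound and the threshold `⋈ p`. All numbers are rational. -/
structure Input (n : ℕ) where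
  locations : List (Owner × Constraint n)
  edges : List (EdgeCode n)
  targets : List ℕ
  startLocation : ℕ
  startClocks : Fin n → ℕ × ℕ
  timeBound : ℕ × ℕ
  cmp : Cmp
  threshold : ℕ × ℕ

/-- Codes of inputs. -/
def inputEquiv (n : ℕ) : Input n ≃ List (Owner × Constraint n) × List (EdgeCode n) × List ℕ × ℕ ×
    (Fin n → ℕ × ℕ) × (ℕ × ℕ) × Cmp × (ℕ × ℕ) where
  toFun I := (I.locations, I.edges, I.targets, I.startLocation, I.startClocks, I.timeBound, I.cmp,
    I.threshold)
  invFun q := ⟨q.1, q.2.1, q.2.2.1, q.2.2.2.1, q.2.2.2.2.1, q.2.2.2.2.2.1, q.2.2.2.2.2.2.1,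
    q.2.2.2.2.2.2.2⟩
  left_inv _ := rfl
  right_inv _ := rfl

instance (n : ℕ) : Primcodable (Input n) :=
  Primcodable.ofEquiv (List (Owner × Constraint n) × List (EdgeCode n) × List ℕ × ℕ ×
    (Fin n → ℕ × ℕ) × (ℕ × ℕ) × Cmp × (ℕ × ℕ)) (inputEquiv n)

namespace Input

variable {n : ℕ} (I : Input n)

/-- The game `G` is the one described by the input; it is non-blocking and has uniform
distributions over delays. There is at most one such game. -/
structure Describes (G : Game I.locations.length n I.edges.length) : Prop where
  owner : ∀ l, G.owner l = (I.locations.get l).1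
  inv : ∀ l, G.inv l = (I.locations.get l).2
  src : ∀ e, (G.src e : ℕ) = (I.edges.get e).src
  guard : ∀ e, G.guard e = (I.edges.get e).guard
  reset : ∀ e, G.reset e = (I.edges.get e).reset.toFinset
  tgt : ∀ e, (G.tgt e : ℕ) = (I.edges.get e).tgt
  weight : ∀ e, G.weight e = (I.edges.get e).weight
  nonBlocking : G.NonBlocking
  uniform : G.HasUniformDelays

/-- The set of target locations. -/
def targetSet : Set (Fin I.locations.length) := {l | (l : ℕ) ∈ I.targets}

/-- `s` is the initial state given by the input. -/
def IsStart (s : State I.locations.length n) : Prop :=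
  (s.1 : ℕ) = I.startLocation ∧ ∀ x, s.2 x = ratVal (I.startClocks x)

/-- The threshold is quantitative: `0 < p < 1`. -/
def IsQuantitative : Prop := 0 < ratVal I.threshold ∧ ratVal I.threshold < 1

end Input

/-- The function `f` solves the time-bounded quantitative reachability problem for all games with `n`
clocks, uniform distributions over delays and the time bound `Δ`. On inputs that do not describe such
a game with an initial state, the value of `f` is arbitrary. -/
def Solves (n : ℕ) (Δ : ℝ) (f : Input n → Bool) : Prop :=
  ∀ (I : Input n) (G : Game I.locations.length n I.edges.length) (s : State I.locations.length n),
    I.Describes G → I.IsStart s → G.IsState s → I.IsQuantitative → ratVal I.timeBound = Δ →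
    (f I = true ↔
      G.DiamondWins s I.targetSet (ratVal I.timeBound) I.cmp (ratVal I.threshold))

end StochasticTimedGame

end

open MeasureTheory ProbabilityTheory
open scoped ENNReal

noncomputable section

namespace StochasticTimedGame

/-! A Turing machine with an undecidable halting problem -/

section Halting

open Turing

/-! The halting problem is reduced to the question whether Player `◇` can enforce the probability
exactly `1/2`.

The intermediate model is a finite control with two numbers in `[0, 1]` that are updated in turn by
affine maps. A Turing machine takes this form when each half-tape is written as a fraction with even
digits `2d`: a push divides by the base, a pop multiplies, and the popped symbol is guessed. A wrong
guess is off by at least 2 and throws the remainder out of `[0, 1]` (`moves_pop_iff`,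
`accepts_take_iff`).

The game stores the numbers in clocks, scaled by the time `r` that is left until the total clock
shows 1. To replace `v` by `v'`, Player `◇` should wait `r(1 - v')/2` and later `r v'/2`. A phase
thus uses half of the remaining time, so infinitely many phases fit into one time unit and the time
bound is no restriction. After the first delay Player `□` may have the value `v'` tested, after the
second one the length of the phase.

A test is a stochastic location. A delay uniform on `[0, 1)` lifts a clock with value `v` to at
least 1 with probability `v` (`lintegral_threshold`). Weighted edges turn this into a probability
that is affine in the clock values, and the weights are such that it equals `1/2` exactly if a
prescribed linear relation holds (`checkValue_false_iff`, `checkValue_true_iff`). Before a test no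
stochastic location is visited, so the history is almost surely a fixed one
(`Game.Follows.ae_firstSteps`).

If the machine accepts, the honest simulation ends in a test, at the accepting transition if not
before, and every test gives `1/2` (`diamondWins_of_accepts`). Conversely, suppose `◇` enforces
`1/2`. In the play in which `□` never challenges, each phase satisfies both relations, because `□`
could have challenged there; hence the play follows genuine transitions of the machine. If the
machine did not accept, this play would go on forever without reaching the goal, and its probability
would be 0 (`accepts_of_diamondWins`). -/

theorem exists_partrec_halting_undecidable :
    ∃ f : ℕ →. ℕ, Partrec f ∧ ¬ ComputablePred fun m => (f (2 ^ m)).Dom := by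
  let g : ℕ →. ℕ := fun m => Nat.Partrec.Code.eval (Denumerable.ofNat Nat.Partrec.Code m) 0
  have hg : Partrec g :=
    Nat.Partrec.Code.eval_part.comp (Computable.ofNat _) (Computable.const 0)
  have hp : Primrec₂ fun k j : ℕ => decide (2 ^ j = k) :=
    Primrec.eq.decide.comp
      ((Primrec₂.unpaired'.1 Nat.Primrec.pow).comp (Primrec.const 2) Primrec.snd) Primrec.fst
  refine ⟨fun k => (Nat.rfind fun j => Part.some (decide (2 ^ j = k))).bind g,
    (Partrec.rfind hp.to_comp.partrec₂).bind (hg.comp Computable.snd), fun h => ?_⟩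
  -- On `2 ^ m` the search returns `m`, so the function runs program number `m` on the input 0.
  have hlog : ∀ m : ℕ, (Nat.rfind fun j => Part.some (decide (2 ^ j = 2 ^ m))) = Part.some m := by
    intro m
    refine Part.eq_some_iff.2 (Nat.mem_rfind.2 ⟨by simp, fun {j} hj => ?_⟩)
    simp [hj.ne]
  simp only [hlog] at h
  refine ComputablePred.halting_problem 0 ?_
  refine (ComputablePred.computable_iff.2 ?_)
  obtain ⟨d, hd, hd'⟩ := ComputablePred.computable_iff.1 h
  refine ⟨fun c => d (Encodable.encode c), hd.comp Computable.encode, ?_⟩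
  funext c
  have := congrFun hd' (Encodable.encode c)
  simpa [g] using this

/-- Powers of two have a binary expansion that is constant up to its last digit. This reduces the
input tapes to a family `x₀ x₁ s ⋯ s`, whose encodings arise by iterating a single map. -/
theorem trNat_two_pow (m : ℕ) :
    PartrecToTM2.trNat (2 ^ m) =
      List.replicate m PartrecToTM2.Γ'.bit0 ++ [PartrecToTM2.Γ'.bit1] := by
  have h : ∀ m : ℕ, ∃ p : PosNum, (((2 ^ m : ℕ)) : Num) = Num.pos p ∧
      PartrecToTM2.trPosNum p =
        List.replicate m PartrecToTM2.Γ'.bit0 ++ [PartrecToTM2.Γ'.bit1] := by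
    intro m
    induction m with
    | zero => exact ⟨PosNum.one, by simp; rfl, rfl⟩
    | succ m ih =>
      obtain ⟨p, hp, hp'⟩ := ih
      refine ⟨PosNum.bit0 p, ?_, ?_⟩
      · have : (((2 ^ (m + 1) : ℕ)) : Num) = ((2 ^ m : ℕ) : Num) + ((2 ^ m : ℕ) : Num) := by
          rw [pow_succ, mul_two, Nat.cast_add]
        rw [this, hp]
        exact congrArg Num.pos (PosNum.bit0_of_bit0 p)
      · rw [PartrecToTM2.trPosNum, hp']
        rfl
  obtain ⟨p, hp, hp'⟩ := h m
  rw [PartrecToTM2.trNat, hp, PartrecToTM2.trNum, hp']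

instance : Fintype PartrecToTM2.K' :=
  ⟨{.main, .rev, .aux, .stack}, fun x => by cases x <;> simp⟩

/-- There is a finite Turing machine whose halting problem is undecidable already for the inputs
`x₀ x₁ s ⋯ s`. -/
theorem exists_machine_halting_undecidable :
    ∃ (Γ Λ : Type) (_ : Fintype Γ) (_ : Inhabited Γ) (_ : Inhabited Λ) (M : TM0.Machine Γ Λ)
      (S : Finset Λ) (x₀ x₁ s : Γ), TM0.Supports M (S : Set Λ) ∧
      ¬ ComputablePred fun m : ℕ => (TM0.eval M (x₀ :: x₁ :: List.replicate m s)).Dom := by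
  obtain ⟨f, hf, hu⟩ := exists_partrec_halting_undecidable
  obtain ⟨c, hc⟩ := ToPartrec.Code.exists_code (Nat.Partrec'.part_iff₁.2 hf)
  -- A machine starts in the default label, so the entry point of the program for `c` is made the
  -- default.
  let _ : Inhabited PartrecToTM2.Λ' := ⟨PartrecToTM2.trNormal c .halt⟩
  let T : PartrecToTM2.Λ' → TM2.Stmt (fun _ : PartrecToTM2.K' => PartrecToTM2.Γ')
    PartrecToTM2.Λ' (Option PartrecToTM2.Γ') := PartrecToTM2.tr
  let sym (a : PartrecToTM2.Γ') : TM2to1.Γ' PartrecToTM2.K' (fun _ => PartrecToTM2.Γ') :=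
    (false, Function.update (fun _ => none) PartrecToTM2.K'.main (some a))
  refine ⟨TM2to1.Γ' PartrecToTM2.K' (fun _ => PartrecToTM2.Γ'), _, inferInstance, inferInstance,
    inferInstance, TM1to0.tr (TM2to1.tr T),
    TM1to0.trStmts _ (TM2to1.trSupp T (PartrecToTM2.codeSupp c .halt)),
    -- The flag `true` marks the bottom of the stacks. A stack lies on the tape in reversed order,
    -- so the end mark `cons` and the leading bit come first.
    (true, (sym .cons).2), sym .bit1, sym .bit0,
    TM1to0.tr_supports _ (TM2to1.tr_supports _ (PartrecToTM2.tr_supports c .halt)), ?_⟩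
  convert hu using 2
  funext m
  have hin : ((true, (sym .cons).2) :: sym .bit1 :: List.replicate m (sym .bit0)) =
      TM2to1.trInit PartrecToTM2.K'.main (PartrecToTM2.trList [2 ^ m]) := by
    have hr : List.replicate m (sym .bit0) = (List.replicate m PartrecToTM2.Γ'.bit0).map sym :=
      (List.map_replicate (f := sym)).symm
    have hl : (PartrecToTM2.trList [2 ^ m]).reverse =
        .cons :: .bit1 :: List.replicate m PartrecToTM2.Γ'.bit0 := by
      simp [PartrecToTM2.trList, trNat_two_pow]
    unfold TM2to1.trInit
    rw [hl]
    exact congrArg (fun l => _ :: _ :: l) hr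
  refine (congrArg (fun l => (TM0.eval (TM1to0.tr (TM2to1.tr T)) l).Dom) hin).trans ?_
  rw [TM1to0.tr_eval, TM2to1.tr_eval_dom]
  have hinit : TM2.init PartrecToTM2.K'.main (PartrecToTM2.trList [2 ^ m]) =
      PartrecToTM2.init c [2 ^ m] := by
    unfold TM2.init PartrecToTM2.init
    congr 1
    funext k
    cases k <;> simp [Function.update]
  rw [TM2.eval, hinit]
  have := PartrecToTM2.tr_eval c [2 ^ m]
  have h2 := hc (⟨[2 ^ m], rfl⟩ : List.Vector ℕ 1)
  simp only [Part.map_Dom]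
  refine propext ?_
  rw [this]
  change (c.eval [2 ^ m]).Dom ↔ _
  exact iff_of_eq (congrArg Part.Dom h2)

end Halting

/-! Affine machines: two numbers in `[0, 1]` are updated alternately by affine maps -/

/-- A finite control whose transition `t` replaces a number `v` by a number `v'` in `[0, 1]` with
`scale t * v' + drop t = coef t * v + gain t`. A transition without a destination accepts. -/
structure AffineMachine where
  Ctrl : Type
  Tr : Type
  [finite_ctrl : Finite Ctrl]
  [finite_tr : Finite Tr]
  src : Tr → Ctrl
  dst : Tr → Option Ctrl
  scale : Tr → ℕ
  coef : Tr → ℕ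
  gain : Tr → ℕ
  drop : Tr → ℕ

namespace AffineMachine

attribute [instance] finite_ctrl finite_tr

variable (M : AffineMachine)

/-- The transition `t` can replace the number `v` by `v'`. -/
def Moves (t : M.Tr) (v v' : ℝ) : Prop :=
  (0 ≤ v' ∧ v' ≤ 1) ∧ M.scale t * v' + M.drop t = M.coef t * v + M.gain t

/-- An accepting transition is reachable; the first number is the next one to be updated. -/
inductive Accepts : M.Ctrl → ℝ → ℝ → Prop
  | halt {t : M.Tr} {v w v' : ℝ} (h : M.Moves t v v') (ht : M.dst t = none) :
      Accepts (M.src t) v w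
  | step {t : M.Tr} {v w v' : ℝ} {c : M.Ctrl} (h : M.Moves t v v') (ht : M.dst t = some c)
      (hc : Accepts c w v') : Accepts (M.src t) v w

end AffineMachine

/-! Turing machines as affine machines -/

section TuringMachine

open Turing

variable {Γ : Type} [Fintype Γ] [Inhabited Γ]

open Classical in
/-- The digit of a tape symbol; the blank has the digit `0`. -/
def digit (g : Γ) : ℕ := if g = default then 0 else Fintype.equivFin Γ g + 1

theorem digit_default : digit (default : Γ) = 0 := if_pos rfl

theorem digit_injective : Function.Injective (digit : Γ → ℕ) := by
  intro a b h
  unfold digit at h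
  split_ifs at h with h1 h2 h2
  · rw [h1, h2]
  · exact (Fintype.equivFin Γ).injective (Fin.ext (by omega))

theorem digit_le (g : Γ) : digit g ≤ Fintype.card Γ := by
  unfold digit
  split_ifs
  · exact Nat.zero_le _
  · exact (Fintype.equivFin Γ g).2

variable (Γ) in
/-- The base of the positional encoding of tape contents. -/
def base : ℕ := 2 * (Fintype.card Γ + 1)

theorem base_pos : (0 : ℝ) < base Γ := by
  unfold base; positivity

theorem two_mul_digit_add_one_le (g : Γ) : 2 * (digit g : ℝ) + 1 ≤ base Γ := by
  have := digit_le g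
  unfold base
  exact_mod_cast (by omega : 2 * digit g + 1 ≤ 2 * (Fintype.card Γ + 1))

/-- The number in `[0, 1]` that encodes a list of tape symbols. -/
def encodeList : List Γ → ℝ
  | [] => 0
  | g :: l => (2 * digit g + encodeList l) / base Γ

/-- The blank has the digit 0, so the encoding passes to half-tapes, which are lists up to trailing
blanks. -/
theorem encodeList_append_blanks (l : List Γ) (i : ℕ) :
    encodeList (l ++ List.replicate i default) = encodeList l := by
  induction l with
  | nil =>
    induction i with
    | zero => rfl
    | succ i ih =>
      rw [List.nil_append] at ih
      simp [List.replicate_succ, encodeList, ih, digit_default]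
  | cons g l ih => simp [encodeList, ih]

theorem encodeList_mem (l : List Γ) : 0 ≤ encodeList l ∧ encodeList l ≤ 1 := by
  induction l with
  | nil => simp [encodeList]
  | cons g l ih =>
    have := two_mul_digit_add_one_le g
    refine ⟨div_nonneg (by linarith [ih.1, (Nat.cast_nonneg (digit g) : (0 : ℝ) ≤ _)])
      base_pos.le, ?_⟩
    rw [encodeList, div_le_one base_pos]
    linarith [ih.2]

/-- The number that encodes a half-tape. -/
def encodeTape (L : ListBlank Γ) : ℝ :=
  L.liftOn encodeList fun a b ⟨i, h⟩ => by rw [h, encodeList_append_blanks]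

theorem encodeTape_mk (l : List Γ) : encodeTape (ListBlank.mk l) = encodeList l := rfl

theorem encodeTape_mem (L : ListBlank Γ) : 0 ≤ encodeTape L ∧ encodeTape L ≤ 1 :=
  L.induction_on encodeList_mem

theorem base_mul_encodeTape_cons (g : Γ) (L : ListBlank Γ) :
    base Γ * encodeTape (L.cons g) = 2 * digit g + encodeTape L := by
  refine L.induction_on fun l => ?_
  rw [ListBlank.cons_mk, encodeTape_mk, encodeTape_mk, encodeList]
  exact mul_div_cancel₀ _ base_pos.ne'

theorem base_mul_encodeTape (L : ListBlank Γ) :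
    base Γ * encodeTape L = 2 * digit L.head + encodeTape L.tail := by
  rw [← base_mul_encodeTape_cons, ListBlank.cons_head_tail]

variable (Γ) in
/-- Actions on a half-tape. -/
inductive TapeAct
  | keep
  | push (g : Γ)
  | pop (g : Γ)

/-- The control of an affine machine that simulates a Turing machine: in `scan q g`, the machine is
in the state `q`, reads `g`, and will update the left half-tape; in the other cases it has to update
the right half-tape before it goes on in the state `q`. -/
inductive TapeCtrl (Γ Q : Type)
  | scan (q : Q) (g : Γ)
  | put (q : Q) (h g : Γ)
  | take (q : Q)
  | stay (q : Q) (g : Γ)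

instance {Q : Type} [Finite Q] : Finite (TapeCtrl Γ Q) := by
  let f : TapeCtrl Γ Q → (Q × Γ) ⊕ (Q × Γ × Γ) ⊕ Q ⊕ (Q × Γ)
    | .scan q g => .inl (q, g)
    | .put q h g => .inr (.inl (q, h, g))
    | .take q => .inr (.inr (.inl q))
    | .stay q g => .inr (.inr (.inr (q, g)))
  refine Finite.of_injective f fun a b h => ?_
  cases a <;> cases b <;> simp_all [f]

variable {Λ : Type} (S : Finset Λ)

open Classical in
/-- A state as an element of the finite set `S`. -/
def restrictState [Nonempty S] (q : Λ) : S :=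
  if h : q ∈ S then ⟨q, h⟩ else Classical.arbitrary S

theorem restrictState_of_mem [Nonempty S] {q : Λ} (h : q ∈ S) : restrictState S q = ⟨q, h⟩ :=
  dif_pos h

variable [Inhabited Λ] (M : TM0.Machine Γ Λ)

/-- The action and the next control; `x` is the guess of the symbol to be removed. -/
def tapeStep [Nonempty S] : TapeCtrl Γ S → Γ → TapeAct Γ × Option (TapeCtrl Γ S)
  | .scan q g, x =>
    match M q.1 g with
    | none => (.keep, none)
    | some (q', .write g') => (.keep, some (.stay (restrictState S q') g'))
    | some (q', .move .right) => (.push g, some (.take (restrictState S q')))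
    | some (q', .move .left) => (.pop x, some (.put (restrictState S q') g x))
  | .put q h g, _ => (.push h, some (.scan q g))
  | .take q, x => (.pop x, some (.scan q x))
  | .stay q g, _ => (.keep, some (.scan q g))

/-- The affine machine that simulates a Turing machine. -/
def tapeMachine [Nonempty S] : AffineMachine where
  Ctrl := TapeCtrl Γ S
  Tr := TapeCtrl Γ S × Γ
  src := Prod.fst
  dst t := (tapeStep S M t.1 t.2).2
  -- A push means `base * v' = v + 2 * digit g`, a pop means `v' + 2 * digit g = base * v`.
  scale t := match (tapeStep S M t.1 t.2).1 with | .push _ => base Γ | _ => 1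
  coef t := match (tapeStep S M t.1 t.2).1 with | .pop _ => base Γ | _ => 1
  gain t := match (tapeStep S M t.1 t.2).1 with | .push g => 2 * digit g | _ => 0
  drop t := match (tapeStep S M t.1 t.2).1 with | .pop g => 2 * digit g | _ => 0

variable {S} [Nonempty S]

theorem moves_keep_iff {t : TapeCtrl Γ S × Γ} (h : (tapeStep S M t.1 t.2).1 = .keep)
    (X : ListBlank Γ) (v' : ℝ) :
    (tapeMachine S M).Moves t (encodeTape X) v' ↔ v' = encodeTape X := by
  have := encodeTape_mem X
  simp only [AffineMachine.Moves, tapeMachine, h, Nat.cast_one, one_mul, Nat.cast_zero, add_zero]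
  exact ⟨fun h => h.2, fun h => ⟨h ▸ this, h⟩⟩

theorem moves_push_iff {t : TapeCtrl Γ S × Γ} {g : Γ} (h : (tapeStep S M t.1 t.2).1 = .push g)
    (X : ListBlank Γ) (v' : ℝ) :
    (tapeMachine S M).Moves t (encodeTape X) v' ↔ v' = encodeTape (X.cons g) := by
  have h1 := encodeTape_mem (X.cons g)
  have h2 := base_mul_encodeTape_cons g X
  have h3 := base_pos (Γ := Γ)
  simp only [AffineMachine.Moves, tapeMachine, h, Nat.cast_one, one_mul, Nat.cast_zero, add_zero,
    Nat.cast_mul, Nat.cast_ofNat]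
  constructor
  · rintro ⟨-, h⟩
    exact mul_left_cancel₀ h3.ne' (by linarith)
  · rintro rfl
    exact ⟨h1, by linarith⟩

/-- The remainder of the true digit lies in `[0, 1]`, and even digits differ by at least 2. So the
range condition on `v'` alone rejects a wrong guess, and the control never has to read a symbol. -/
theorem moves_pop_iff {t : TapeCtrl Γ S × Γ} {g : Γ} (h : (tapeStep S M t.1 t.2).1 = .pop g)
    (X : ListBlank Γ) (v' : ℝ) :
    (tapeMachine S M).Moves t (encodeTape X) v' ↔ g = X.head ∧ v' = encodeTape X.tail := by
  have h1 := encodeTape_mem X.tail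
  have h2 := base_mul_encodeTape X
  simp only [AffineMachine.Moves, tapeMachine, h, Nat.cast_one, one_mul, Nat.cast_zero, add_zero,
    Nat.cast_mul, Nat.cast_ofNat]
  constructor
  · rintro ⟨⟨h3, h4⟩, h⟩
    have hd : digit g = digit X.head := by
      have h5 : (digit g : ℝ) < digit X.head + 1 := by linarith
      have h6 : (digit X.head : ℝ) < digit g + 1 := by linarith
      have h5' : digit g < digit X.head + 1 := by exact_mod_cast h5
      have h6' : digit X.head < digit g + 1 := by exact_mod_cast h6
      omega
    rw [hd] at h
    exact ⟨digit_injective hd, by linarith⟩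
  · rintro ⟨rfl, rfl⟩
    exact ⟨h1, by linarith⟩

/-- The configuration of the Turing machine that is encoded by a control and two half-tapes, the
first of which will be updated next. -/
def tapeCfg : TapeCtrl Γ S → ListBlank Γ → ListBlank Γ → TM0.Cfg Γ Λ
  | .scan q g, X, Y => ⟨q.1, ⟨g, X, Y⟩⟩
  | .put q h g, X, Y => ⟨q.1, ⟨g, Y, X.cons h⟩⟩
  | .take q, X, Y => ⟨q.1, ⟨X.head, Y, X.tail⟩⟩
  | .stay q g, X, Y => ⟨q.1, ⟨g, Y, X⟩⟩

theorem eval_dom_of_step {σ : Type} {f : σ → Option σ} {a b : σ} (h : f a = some b) :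
    (StateTransition.eval f a).Dom ↔ (StateTransition.eval f b).Dom := by
  rw [StateTransition.reaches_eval (Relation.ReflTransGen.single (show b ∈ f a from h))]

variable {M}

/-- Induction on acceptance. Transitions out of `scan` perform one Turing step on the configuration
`tapeCfg`; the others complete the update of the second half-tape and leave this configuration
unchanged. -/
theorem eval_dom_of_accepts (hS : TM0.Supports M (S : Set Λ)) {c : (tapeMachine S M).Ctrl} {v w : ℝ}
    (h : (tapeMachine S M).Accepts c v w) :
    ∀ X Y : ListBlank Γ, v = encodeTape X → w = encodeTape Y →
      (StateTransition.eval (TM0.step M) (tapeCfg c X Y)).Dom := by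
  induction h with
  | @halt t v w v' h ht =>
    rintro X Y rfl rfl
    obtain ⟨c, x⟩ := t
    have hc : (tapeMachine S M).src (c, x) = c := rfl
    rw [hc]
    change (tapeStep S M c x).2 = none at ht
    cases c with
    | scan q g =>
      rcases hM : M q.1 g with _ | ⟨q', (d | g')⟩
      · refine Part.dom_iff_mem.2 ⟨_, StateTransition.mem_eval.2 ⟨Relation.ReflTransGen.refl, ?_⟩⟩
        simp [tapeCfg, TM0.step, hM]
      · cases d <;> simp [tapeStep, hM] at ht
      · simp [tapeStep, hM] at ht
    | put q h g => simp [tapeStep] at ht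
    | take q => simp [tapeStep] at ht
    | stay q g => simp [tapeStep] at ht
  | @step t v w v' c' h ht hc' ih =>
    rintro X Y rfl rfl
    obtain ⟨c, x⟩ := t
    have hc : (tapeMachine S M).src (c, x) = c := rfl
    rw [hc]
    change (tapeStep S M c x).2 = some c' at ht
    cases c with
    | scan q g =>
      rcases hM : M q.1 g with _ | ⟨q', (d | g')⟩
      · simp [tapeStep, hM] at ht
      · have hq' : q' ∈ S := hS.2 hM q.2
        cases d
        · simp only [tapeStep, hM] at ht
          obtain ⟨rfl, rfl⟩ :=
            (moves_pop_iff M (g := x) (by simp [tapeStep, hM]) X v').1 h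
          obtain rfl := Option.some.inj ht
          have := ih Y X.tail rfl rfl
          rw [eval_dom_of_step (b := tapeCfg (.put (restrictState S q') g X.head) Y X.tail)]
          · exact this
          · simp [tapeCfg, TM0.step, hM, restrictState_of_mem S hq', Tape.move]
        · simp only [tapeStep, hM] at ht
          obtain rfl := (moves_push_iff M (by simp [tapeStep, hM]; rfl) X v').1 h
          obtain rfl := Option.some.inj ht
          have := ih Y (X.cons g) rfl rfl
          rw [eval_dom_of_step (b := tapeCfg (.take (restrictState S q')) Y (X.cons g))]
          · exact this
          · simp [tapeCfg, TM0.step, hM, restrictState_of_mem S hq', Tape.move]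
      · have hq' : q' ∈ S := hS.2 hM q.2
        simp only [tapeStep, hM] at ht
        obtain rfl := (moves_keep_iff M (by simp [tapeStep, hM]) X v').1 h
        obtain rfl := Option.some.inj ht
        have := ih Y X rfl rfl
        rw [eval_dom_of_step (b := tapeCfg (.stay (restrictState S q') g') Y X)]
        · exact this
        · simp [tapeCfg, TM0.step, hM, restrictState_of_mem S hq', Tape.write]
    | put q h' g =>
      simp only [tapeStep] at ht
      obtain rfl := (moves_push_iff M rfl X v').1 h
      obtain rfl := Option.some.inj ht
      exact ih Y (X.cons h') rfl rfl
    | take q =>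
      simp only [tapeStep] at ht
      obtain ⟨rfl, rfl⟩ := (moves_pop_iff M rfl X v').1 h
      obtain rfl := Option.some.inj ht
      exact ih Y X.tail rfl rfl
    | stay q g =>
      simp only [tapeStep] at ht
      obtain rfl := (moves_keep_iff M rfl X v').1 h
      obtain rfl := Option.some.inj ht
      exact ih Y X rfl rfl

/-- Induction along the halting computation: each Turing step becomes two affine transitions, on the
left half-tape and then on the right one. -/
theorem accepts_scan_of_eval_dom (hS : TM0.Supports M (S : Set Λ)) {a b : TM0.Cfg Γ Λ}
    (h : b ∈ StateTransition.eval (TM0.step M) a) :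
    ∀ hq : a.q ∈ S, (tapeMachine S M).Accepts (.scan ⟨a.q, hq⟩ a.Tape.head)
      (encodeTape a.Tape.left) (encodeTape a.Tape.right) := by
  refine StateTransition.evalInduction
    (C := fun a => ∀ hq : a.q ∈ S, (tapeMachine S M).Accepts (.scan ⟨a.q, hq⟩ a.Tape.head)
      (encodeTape a.Tape.left) (encodeTape a.Tape.right)) h ?_
  rintro ⟨q, g, X, Y⟩ - ih hq
  rcases hM : M q g with _ | ⟨q', (d | g')⟩
  · exact .halt (M := tapeMachine S M) (t := (.scan ⟨q, hq⟩ g, default))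
      ((moves_keep_iff M (by simp [tapeStep, hM]) X _).2 rfl) (by simp [tapeMachine, tapeStep, hM])
  · have hq' : q' ∈ S := hS.2 hM hq
    cases d
    · refine .step (M := tapeMachine S M) (t := (.scan ⟨q, hq⟩ g, X.head))
        (c := .put ⟨q', hq'⟩ g X.head)
        ((moves_pop_iff M (by simp [tapeStep, hM]) X _).2 ⟨rfl, rfl⟩)
        (by simp [tapeMachine, tapeStep, hM, restrictState_of_mem S hq']) ?_
      refine .step (M := tapeMachine S M) (t := (.put ⟨q', hq'⟩ g X.head, default))
        (c := .scan ⟨q', hq'⟩ X.head) ((moves_push_iff M rfl Y _).2 rfl) rfl ?_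
      exact ih ⟨q', ⟨X.head, X.tail, Y.cons g⟩⟩ (by simp [TM0.step, hM, Tape.move]) hq'
    · refine .step (M := tapeMachine S M) (t := (.scan ⟨q, hq⟩ g, default))
        (c := .take ⟨q', hq'⟩)
        ((moves_push_iff M (by simp [tapeStep, hM]; rfl) X _).2 rfl)
        (by simp [tapeMachine, tapeStep, hM, restrictState_of_mem S hq']) ?_
      refine .step (M := tapeMachine S M) (t := (.take ⟨q', hq'⟩, Y.head))
        (c := .scan ⟨q', hq'⟩ Y.head) ((moves_pop_iff M rfl Y _).2 ⟨rfl, rfl⟩) rfl ?_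
      exact ih ⟨q', ⟨Y.head, X.cons g, Y.tail⟩⟩ (by simp [TM0.step, hM, Tape.move]) hq'
  · have hq' : q' ∈ S := hS.2 hM hq
    refine .step (M := tapeMachine S M) (t := (.scan ⟨q, hq⟩ g, default))
      (c := .stay ⟨q', hq'⟩ g')
      ((moves_keep_iff M (by simp [tapeStep, hM]) X _).2 rfl)
      (by simp [tapeMachine, tapeStep, hM, restrictState_of_mem S hq']) ?_
    refine .step (M := tapeMachine S M) (t := (.stay ⟨q', hq'⟩ g', default))
      (c := .scan ⟨q', hq'⟩ g') ((moves_keep_iff M rfl Y _).2 rfl) rfl ?_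
    exact ih ⟨q', ⟨g', X, Y⟩⟩ (by simp [TM0.step, hM, Tape.write]) hq'

/-- The control `take` fetches the scanned symbol from the right half-tape. Starting there, the
whole input is one number and the empty left half-tape is 0. -/
theorem accepts_take_iff (hS : TM0.Supports M (S : Set Λ)) (l : List Γ) :
    (tapeMachine S M).Accepts (.take ⟨default, hS.1⟩) (encodeList l) 0 ↔ (TM0.eval M l).Dom := by
  have hd : (TM0.eval M l).Dom ↔ (StateTransition.eval (TM0.step M) (TM0.init l)).Dom := Iff.rfl
  rw [hd]
  constructor
  · intro h
    exact eval_dom_of_accepts hS h (ListBlank.mk l) (ListBlank.mk []) rfl rfl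
  · intro h
    obtain ⟨b, hb⟩ := Part.dom_iff_mem.1 h
    refine .step (M := tapeMachine S M) (t := (.take ⟨default, hS.1⟩, (ListBlank.mk l).head))
      (c := .scan ⟨default, hS.1⟩ (ListBlank.mk l).head)
      ((moves_pop_iff M rfl (ListBlank.mk l) _).2 ⟨rfl, rfl⟩) rfl ?_
    exact accepts_scan_of_eval_dom hS hb hS.1

end TuringMachine

/-! Transitions and runs -/

section Runs

variable {m n k : ℕ}

/-- Each atom defines a convex set. Hence the invariant need only be tested at the end of a delay,
which removes the quantifier over times from `Trans` and makes it measurable. -/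
theorem Sat.interpolate {g : Constraint n} {ν : Fin n → ℝ} {t u : ℝ} (h0 : Sat ν g)
    (h1 : Sat (fun x => ν x + t) g) (hu : u ∈ Set.Icc 0 t) : Sat (fun x => ν x + u) g := by
  rintro ⟨x, c, q⟩ ha
  have h0 := h0 _ ha
  have h1 := h1 _ ha
  obtain ⟨hu0, hu1⟩ := hu
  cases c <;> simp only [Cmp.Holds] at * <;> linarith

namespace TimedAutomaton

variable (A : TimedAutomaton m n k)

theorem trans_iff (s : State m n) (a : Step k) :
    A.Trans s a ↔ A.IsState s ∧ A.src a.2 = s.1 ∧ 0 ≤ a.1 ∧ Sat (s.delay a.1).2 (A.inv s.1) ∧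
      Sat (s.delay a.1).2 (A.guard a.2) ∧ A.IsState (A.succ s a) := by
  constructor
  · rintro ⟨h1, h2, h3, h4, h5, h6⟩
    exact ⟨h1, h2, h3, h4 _ ⟨h3, le_rfl⟩, h5, h6⟩
  · rintro ⟨h1, h2, h3, h4, h5, h6⟩
    exact ⟨h1, h2, h3, fun t ht => h1.2.interpolate h4 ht, h5, h6⟩

theorem measurableSet_trans : MeasurableSet {q : State m n × Step k | A.Trans q.1 q.2} := by
  have hsat (g : Fin m → Fin k → Constraint n) :
      MeasurableSet {q : State m n × Step k | Sat (q.1.delay q.2.1).2 (g q.1.1 q.2.2)} := by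
    have : {q : State m n × Step k | Sat (q.1.delay q.2.1).2 (g q.1.1 q.2.2)} =
        ⋃ l : Fin m, ⋃ e : Fin k, ({q | q.1.1 = l} ∩ {q | q.2.2 = e}) ∩
          (fun q : State m n × Step k => (q.1.delay q.2.1).2) ⁻¹' {ν | Sat ν (g l e)} := by
      ext q; simp
    rw [this]
    refine MeasurableSet.iUnion fun l => MeasurableSet.iUnion fun e =>
      MeasurableSet.inter (MeasurableSet.inter ?_ ?_) ?_
    · exact measurable_fst.fst (measurableSet_singleton l)
    · exact measurable_snd.snd (measurableSet_singleton e)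
    · refine MeasurableSet.preimage (Game.measurableSet_sat _) ?_
      exact (Game.measurable_delay.comp (measurable_fst.prodMk measurable_snd.fst)).snd
  have : {q : State m n × Step k | A.Trans q.1 q.2} =
      (Prod.fst ⁻¹' {s | A.IsState s}) ∩ ({q | A.src q.2.2 = q.1.1} ∩ ({q | 0 ≤ q.2.1} ∩
        ({q | Sat (q.1.delay q.2.1).2 (A.inv q.1.1)} ∩
          ({q | Sat (q.1.delay q.2.1).2 (A.guard q.2.2)} ∩
            (fun q => A.succ q.1 q.2) ⁻¹' {s | A.IsState s})))) := by
    ext q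
    exact A.trans_iff q.1 q.2
  rw [this]
  refine (measurable_fst (Game.measurableSet_isState A)).inter (.inter ?_ (.inter ?_
    (.inter (hsat fun l _ => A.inv l) (.inter (hsat fun _ e => A.guard e)
      (Game.measurable_succ A (Game.measurableSet_isState A))))))
  · exact measurableSet_eq_fun ((measurable_of_finite A.src).comp measurable_snd.snd)
      measurable_fst.fst
  · exact measurableSet_le measurable_const measurable_snd.fst

theorem measurableSet_delays (s : State m n) : MeasurableSet (A.delays s) :=
  MeasurableSet.iUnion fun _ =>
    (measurable_const.prodMk (measurable_id.prodMk measurable_const)) A.measurableSet_trans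

theorem Trans.isState_succ {A : TimedAutomaton m n k} {s : State m n} {a : Step k}
    (h : A.Trans s a) : A.IsState (A.succ s a) := h.2.2.2.2.2

theorem IsRun.isState {A : TimedAutomaton m n k} {s : State m n} {j : ℕ} {h : Fin j → Step k}
    (hr : A.IsRun s j h) : A.IsState (A.stateAfter s j h) := by
  cases j with
  | zero => exact hr
  | succ j => exact hr.2.isState_succ

theorem succ_delay (s : State m n) (t : ℝ) (e : Fin k) :
    A.succ (s.delay t) (0, e) = A.succ s (t, e) := by
  simp [succ, State.delay]

theorem Trans.delay_isState {A : TimedAutomaton m n k} {s : State m n} {a : Step k}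
    (h : A.Trans s a) : A.IsState (s.delay a.1) :=
  ⟨fun x => add_nonneg (h.1.1 x) h.2.2.1, h.2.2.2.1 _ ⟨h.2.2.1, le_rfl⟩⟩

theorem Trans.enabled {A : TimedAutomaton m n k} {s : State m n} {a : Step k}
    (h : A.Trans s a) : A.Enabled (s.delay a.1) a.2 := by
  rw [Enabled, trans_iff]
  refine ⟨h.delay_isState, h.2.1, le_rfl, ?_, ?_, ?_⟩
  · simpa [State.delay] using h.delay_isState.2
  · simpa [State.delay] using h.2.2.2.2.1
  · rw [succ_delay]; exact h.isState_succ

theorem Trans.of_enabled {A : TimedAutomaton m n k} {s : State m n} {a : Step k} {e : Fin k}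
    (h : A.Trans s a) (he : A.Enabled (s.delay a.1) e) : A.Trans s (a.1, e) := by
  rw [Enabled, trans_iff, succ_delay] at he
  rw [trans_iff]
  refine ⟨h.1, he.2.1, h.2.2.1, h.delay_isState.2, ?_, he.2.2.2.2.2⟩
  simpa [State.delay] using he.2.2.2.2.1

end TimedAutomaton

end Runs

/-! The law of the runs -/

namespace Game

section Law

variable {m n k : ℕ} {G : Game m n k} (s : State m n) (σ : G.Strategy .diamond)
  (τ : G.Strategy .box)

instance : IsProbabilityMeasure (runMeasure s σ τ) := by
  unfold runMeasure; infer_instance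

/-- The first `j` steps of a run. -/
def firstSteps (j : ℕ) (ω : ℕ → Step k) : Fin j → Step k := fun i => ω i

@[fun_prop]
theorem measurable_firstSteps (j : ℕ) :
    Measurable (firstSteps j : (ℕ → Step k) → Fin j → Step k) :=
  measurable_pi_lambda _ fun _ => measurable_pi_apply _

theorem init_firstSteps (j : ℕ) (ω : ℕ → Step k) :
    Fin.init (firstSteps (j + 1) ω) = firstSteps j ω := rfl

theorem runMeasure_map_zero :
    (runMeasure s σ τ).map (fun ω => ω 0) = nextKernel s σ τ 0 Fin.elim0 := by
  have h1 : (runMeasure s σ τ).map (Preorder.frestrictLe 0) =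
      (nextKernel s σ τ 0 Fin.elim0).map
        (MeasurableEquiv.piUnique (fun _ : Finset.Iic 0 => Step k)).symm := by
    unfold runMeasure Kernel.trajMeasure
    rw [Measure.map_comp _ _ (by fun_prop), Kernel.traj_map_frestrictLe, Kernel.partialTraj_self,
      Measure.id_comp]
  have h2 : (runMeasure s σ τ).map (fun ω => ω 0) = ((runMeasure s σ τ).map
      (Preorder.frestrictLe 0)).map (fun x => x ⟨0, Finset.mem_Iic.2 le_rfl⟩) := by
    rw [Measure.map_map (by fun_prop) (by fun_prop)]
    rfl
  rw [h2, h1, Measure.map_map (by fun_prop) (by fun_prop)]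
  exact Measure.map_id

/-- The trajectory measure treats the initial law and the later kernels differently and indexes
histories by `Finset.Iic j`. This is the uniform version, with histories indexed by `Fin j`. -/
theorem runMeasure_step (j : ℕ) :
    (runMeasure s σ τ).map (fun ω => (firstSteps j ω, ω j)) =
      (runMeasure s σ τ).map (firstSteps j) ⊗ₘ nextKernel s σ τ j := by
  cases j with
  | zero =>
    have h0 : (firstSteps 0 : (ℕ → Step k) → Fin 0 → Step k) = fun _ => Fin.elim0 :=
      funext fun _ => Subsingleton.elim _ _
    have h1 : (fun ω : ℕ → Step k => (firstSteps 0 ω, ω 0)) =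
        Prod.mk (Fin.elim0 : Fin 0 → Step k) ∘ fun ω => ω 0 :=
      funext fun _ => Prod.ext (Subsingleton.elim _ _) rfl
    rw [h1, h0, Measure.map_const, measure_univ, one_smul, ← Measure.map_map (by fun_prop)
      (by fun_prop), runMeasure_map_zero]
    ext B hB
    rw [Measure.dirac_compProd_apply hB, Measure.map_apply (by fun_prop) hB]
  | succ j =>
    let φ : ((_ : Finset.Iic j) → Step k) → Fin (j + 1) → Step k :=
      fun h i => h ⟨i, Finset.mem_Iic.2 (Nat.lt_succ_iff.1 i.2)⟩
    have hφ : Measurable φ := measurable_pi_lambda _ fun _ => measurable_pi_apply _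
    have hm := Kernel.map_frestrictLe_trajMeasure_compProd_eq_map_trajMeasure
      (X := fun _ => Step k) (μ₀ := nextKernel s σ τ 0 Fin.elim0) (κ := historyKernel s σ τ) (a := j)
    change (runMeasure s σ τ).map _ ⊗ₘ _ = (runMeasure s σ τ).map _ at hm
    ext B hB
    have h1 := congrArg (fun μ => μ (Prod.map φ id ⁻¹' B)) hm
    beta_reduce at h1
    rw [Measure.compProd_apply ((hφ.prodMap measurable_id) hB), Measure.map_apply (by fun_prop)
      ((hφ.prodMap measurable_id) hB), lintegral_map
        (Kernel.measurable_kernel_prodMk_left ((hφ.prodMap measurable_id) hB)) (by fun_prop)] at h1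
    rw [Measure.compProd_apply hB, Measure.map_apply (by fun_prop) hB, lintegral_map
      (Kernel.measurable_kernel_prodMk_left hB) (by fun_prop)]
    exact h1.symm

variable {s σ τ}

theorem ae_firstSteps_succ_iff {j : ℕ} {p : (Fin j → Step k) → Step k → Prop}
    (hp : MeasurableSet {q : (Fin j → Step k) × Step k | p q.1 q.2}) :
    (∀ᵐ ω ∂runMeasure s σ τ, p (firstSteps j ω) (ω j)) ↔
      ∀ᵐ ω ∂runMeasure s σ τ, ∀ᵐ a ∂nextKernel s σ τ j (firstSteps j ω), p (firstSteps j ω) a := by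
  have h := Measure.ae_compProd_iff (μ := (runMeasure s σ τ).map (firstSteps j))
    (κ := nextKernel s σ τ j) (p := fun q => p q.1 q.2) hp
  rw [← runMeasure_step, ae_map_iff (by fun_prop) hp, ae_map_iff (by fun_prop)] at h
  · exact h
  · exact (Kernel.measurable_kernel_prodMk_left (κ := nextKernel s σ τ j) hp.compl)
      (measurableSet_singleton 0)

theorem map_step_of_ae_firstSteps {j : ℕ} {h : Fin j → Step k}
    (hh : ∀ᵐ ω ∂runMeasure s σ τ, firstSteps j ω = h) {B : Set (Step k)} (hB : MeasurableSet B) :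
    runMeasure s σ τ {ω | ω j ∈ B} = nextKernel s σ τ j h B := by
  have h1 : (runMeasure s σ τ).map (firstSteps j) = Measure.dirac h := by
    rw [Measure.map_congr (g := fun _ => h) hh, Measure.map_const, measure_univ, one_smul]
  have h2 := congrArg (fun μ => μ (Prod.snd ⁻¹' B)) (runMeasure_step s σ τ j)
  beta_reduce at h2
  rw [Measure.map_apply (by fun_prop) (measurable_snd hB), h1,
    Measure.dirac_compProd_apply (measurable_snd hB)] at h2
  exact h2

theorem nextKernel_of_diamond {j : ℕ} {h : Fin j → Step k}
    (ho : G.owner (G.stateAfter s j h).1 = .diamond) :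
    nextKernel s σ τ j h = Measure.dirac (σ.move s j h) := by
  classical
  rw [nextKernel, Kernel.piecewise_apply, if_pos (by exact ho), Kernel.deterministic_apply]

theorem nextKernel_of_box {j : ℕ} {h : Fin j → Step k}
    (ho : G.owner (G.stateAfter s j h).1 = .box) :
    nextKernel s σ τ j h = Measure.dirac (τ.move s j h) := by
  classical
  rw [nextKernel, Kernel.piecewise_apply, if_neg (by simp [ho]), Kernel.piecewise_apply,
    if_pos (by exact ho), Kernel.deterministic_apply]

theorem nextKernel_of_stochastic {j : ℕ} {h : Fin j → Step k}
    (ho : G.owner (G.stateAfter s j h).1 = .stochastic) :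
    nextKernel s σ τ j h = stochasticKernel s σ j h := by
  classical
  rw [nextKernel, Kernel.piecewise_apply, if_neg (by simp [ho]), Kernel.piecewise_apply,
    if_neg (by simp [ho])]

/-- The steps `h` are made by the players `◇` and `□` according to their strategies. -/
def Follows (s : State m n) (σ : G.Strategy .diamond) (τ : G.Strategy .box) :
    (j : ℕ) → (Fin j → Step k) → Prop
  | 0, _ => True
  | j + 1, h => Follows s σ τ j (Fin.init h) ∧
      ((G.owner (G.stateAfter s j (Fin.init h)).1 = .diamond ∧
          h (Fin.last j) = σ.move s j (Fin.init h)) ∨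
        (G.owner (G.stateAfter s j (Fin.init h)).1 = .box ∧
          h (Fin.last j) = τ.move s j (Fin.init h)))

theorem Follows.isRun (hs : G.IsState s) {j : ℕ} {h : Fin j → Step k} (hf : Follows s σ τ j h) :
    G.IsRun s j h := by
  induction j with
  | zero => exact hs
  | succ j ih =>
    refine ⟨ih hf.1, ?_⟩
    rcases hf.2 with ⟨ho, he⟩ | ⟨ho, he⟩
    · rw [he]; exact σ.legal _ _ _ (ih hf.1) ho
    · rw [he]; exact τ.legal _ _ _ (ih hf.1) ho

/-- Along such a history only the players move, so every kernel is a Dirac measure and the prefix is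
almost surely this one. -/
theorem Follows.ae_firstSteps {j : ℕ} {h : Fin j → Step k} (hf : Follows s σ τ j h) :
    ∀ᵐ ω ∂runMeasure s σ τ, firstSteps j ω = h := by
  induction j with
  | zero => exact Filter.Eventually.of_forall fun _ => Subsingleton.elim _ _
  | succ j ih =>
    have h1 : nextKernel s σ τ j (Fin.init h) = Measure.dirac (h (Fin.last j)) := by
      rcases hf.2 with ⟨ho, he⟩ | ⟨ho, he⟩
      · rw [he, nextKernel_of_diamond ho]
      · rw [he, nextKernel_of_box ho]
    have h2 : ∀ᵐ ω ∂runMeasure s σ τ, ω j = h (Fin.last j) := by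
      rw [ae_iff]
      change runMeasure s σ τ {ω | ω j ∈ ({h (Fin.last j)}ᶜ : Set (Step k))} = 0
      rw [map_step_of_ae_firstSteps (ih hf.1) (measurableSet_singleton _).compl, h1]
      simp
    filter_upwards [ih hf.1, h2] with ω e1 e2
    rw [← Fin.snoc_init_self h, ← Fin.snoc_init_self (firstSteps (j + 1) ω), init_firstSteps, e1]
    exact congrArg _ e2

/-- In a stochastic location, almost surely a possible delay and an enabled edge are chosen. -/
theorem ae_trans_stochasticKernel {j : ℕ} {h : Fin j → Step k} (hr : G.IsRun s j h)
    (ho : G.owner (G.stateAfter s j h).1 = .stochastic) :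
    ∀ᵐ a ∂stochasticKernel s σ j h, G.Trans (G.stateAfter s j h) a := by
  unfold stochasticKernel
  have hm : MeasurableSet {a : Step k | G.Trans (G.stateAfter s j h) a} :=
    (measurable_const.prodMk measurable_id) G.toTimedAutomaton.measurableSet_trans
  rw [Kernel.ae_compProd_iff hm]
  rw [Kernel.comap_apply]
  have h1 : ∀ᵐ t ∂G.μ (G.stateAfter s j h), t ∈ G.delays (G.stateAfter s j h) := by
    exact (mem_ae_iff_prob_eq_one₀ (G.measurableSet_delays _).nullMeasurableSet).2
      (G.μ_delays _ hr.isState ho)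
  filter_upwards [h1] with t ht
  obtain ⟨e', he'⟩ := Set.mem_iUnion.1 ht
  have he' : G.Trans (G.stateAfter s j h) (t, e') := he'
  change ∀ᵐ e ∂G.edgeLaw ((G.stateAfter s j h).delay t) (σ.move s j h).2, _
  have hw : 0 < G.enabledWeight ((G.stateAfter s j h).delay t) e' := by
    rw [enabledWeight, if_pos he'.enabled]
    refine G.weight_pos e' ?_
    rw [he'.2.1]; exact ho
  -- Some edge is enabled after a possible delay, so the default value of `edgeLaw` does not occur.
  have hW : G.totalWeight ((G.stateAfter s j h).delay t) ≠ 0 :=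
    (hw.trans_le (Finset.single_le_sum (f := fun e => G.enabledWeight _ e)
      (fun _ _ => Nat.zero_le _) (Finset.mem_univ e'))).ne'
  rw [edgeLaw, if_neg hW, ae_iff, Measure.coe_finsetSum, Finset.sum_apply]
  refine Finset.sum_eq_zero fun e _ => ?_
  rw [Measure.smul_apply, smul_eq_mul, mul_eq_zero, or_iff_not_imp_left]
  intro hne
  have hen : G.Enabled ((G.stateAfter s j h).delay t) e := by
    by_contra hc
    exact hne (by simp [enabledWeight, hc])
  simp [he'.of_enabled hen]

/-- Strategies are legal along runs only, and `μ` is carried by the possible delays, so legality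
propagates step by step. It is needed because `goal` and `sink` are absorbing only under legal
steps. -/
theorem ae_isRun (hs : G.IsState s) :
    ∀ᵐ ω ∂runMeasure s σ τ, ∀ j, G.IsRun s j (firstSteps j ω) := by
  rw [ae_all_iff]
  intro j
  induction j with
  | zero => exact Filter.Eventually.of_forall fun _ => hs
  | succ j ih =>
    have h1 : ∀ᵐ ω ∂runMeasure s σ τ, G.Trans (G.stateAfter s j (firstSteps j ω)) (ω j) := by
      rw [ae_firstSteps_succ_iff (p := fun h a => G.Trans (G.stateAfter s j h) a)
        ((((measurable_stateAfter _ s j).comp measurable_fst).prodMk measurable_snd)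
          G.toTimedAutomaton.measurableSet_trans)]
      filter_upwards [ih] with ω hω
      rcases ho : G.owner (G.stateAfter s j (firstSteps j ω)).1 with _ | _ | _
      · rw [nextKernel_of_diamond ho, ae_dirac_eq]
        exact σ.legal _ _ _ hω ho
      · rw [nextKernel_of_box ho, ae_dirac_eq]
        exact τ.legal _ _ _ hω ho
      · rw [nextKernel_of_stochastic ho]
        exact ae_trans_stochasticKernel hω ho
    filter_upwards [ih, h1] with ω e1 e2 using ⟨e1, e2⟩

end Law

end Game

/-! Games with uniformly distributed delays -/

section Uniform

variable {m n k : ℕ} (A : TimedAutomaton m n k)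

/-- The uniform distribution over the delays that are possible in a state. -/
def uniformDelays : Kernel (State m n) ℝ where
  toFun s := volume[|A.delays s]
  measurable' := by
    have hm : MeasurableSet {q : State m n × ℝ | q.2 ∈ A.delays q.1} := by
      have : {q : State m n × ℝ | q.2 ∈ A.delays q.1} =
          ⋃ e : Fin k, (fun q : State m n × ℝ => (q.1, (q.2, e))) ⁻¹' {q | A.Trans q.1 q.2} := by
        ext q; simp [TimedAutomaton.delays, TimedAutomaton.delaysVia]
      rw [this]
      exact MeasurableSet.iUnion fun e =>
        (measurable_fst.prodMk (measurable_snd.prodMk measurable_const)) A.measurableSet_trans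
    refine Measure.measurable_of_measurable_coe _ fun B hB => ?_
    have : (fun s : State m n => volume[|A.delays s] B) =
        fun s => (volume (A.delays s))⁻¹ * volume (A.delays s ∩ B) :=
      funext fun s => cond_apply (A.measurableSet_delays s) volume B
    rw [this]
    exact (measurable_measure_prodMk_left hm).inv.mul
      (measurable_measure_prodMk_left (hm.inter (measurable_snd hB)))

/-- The states of stochastic locations. -/
def stochasticStates (owner : Fin m → Owner) : Set (State m n) :=
  {s | A.IsState s ∧ owner s.1 = .stochastic}

theorem measurableSet_stochasticStates (owner : Fin m → Owner) :
    MeasurableSet (stochasticStates A owner) :=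
  (Game.measurableSet_isState A).inter
    (measurable_fst (Set.toFinite {l | owner l = .stochastic}).measurableSet)

open Classical in
/-- The game on a timed automaton with uniformly distributed delays, provided that in all states of
stochastic locations the delays form a nondegenerate interval `[0, b)`. -/
def uniformGame (owner : Fin m → Owner) (weight : Fin k → ℕ)
    (hw : ∀ e, owner (A.src e) = .stochastic → 0 < weight e)
    (hd : ∀ s, A.IsState s → owner s.1 = .stochastic → ∃ b > 0, A.delays s = Set.Ico 0 b) :
    Game m n k :=
  have hvol : ∀ s, A.IsState s → owner s.1 = .stochastic →
      volume (A.delays s) ≠ 0 ∧ volume (A.delays s) ≠ ⊤ := fun s hs ho => by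
    obtain ⟨b, hb, h⟩ := hd s hs ho
    simp [h, hb]
  { toTimedAutomaton := A
    owner := owner
    weight := weight
    μ := Kernel.piecewise (measurableSet_stochasticStates A owner) (uniformDelays A)
      (Kernel.const _ (Measure.dirac 0))
    markov := ⟨fun s => by
      rw [Kernel.piecewise_apply]
      split_ifs with h
      · exact cond_isProbabilityMeasure_of_finite (hvol s h.1 h.2).1 (hvol s h.1 h.2).2
      · rw [Kernel.const_apply]; infer_instance⟩
    weight_pos := hw
    μ_delays := fun s hs ho => by
      rw [Kernel.piecewise_apply, if_pos ⟨hs, ho⟩]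
      exact cond_apply_self (hvol s hs ho).1 (hvol s hs ho).2
    μ_equiv := fun s hs ho _ B hB _ => by
      rw [Kernel.piecewise_apply, if_pos ⟨hs, ho⟩]
      change _ ↔ volume[|A.delays s] B = 0
      rw [cond_apply (A.measurableSet_delays s), Set.inter_eq_right.2 hB, mul_eq_zero,
        ENNReal.inv_eq_zero]
      simp [(hvol s hs ho).2]
    μ_default := fun s hs => by
      exact (Kernel.piecewise_apply _).trans ((if_neg hs).trans (Kernel.const_apply _ _)) }

variable {A} {owner : Fin m → Owner} {weight : Fin k → ℕ}
  {hw : ∀ e, owner (A.src e) = .stochastic → 0 < weight e}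
  {hd : ∀ s, A.IsState s → owner s.1 = .stochastic → ∃ b > 0, A.delays s = Set.Ico 0 b}

theorem uniformGame_μ {s : State m n} (hs : A.IsState s) (ho : owner s.1 = .stochastic) :
    (uniformGame A owner weight hw hd).μ s = volume[|A.delays s] := by
  classical
  exact (Kernel.piecewise_apply (hs := measurableSet_stochasticStates A owner) s).trans
    (if_pos ⟨hs, ho⟩)

theorem uniformGame_hasUniformDelays : (uniformGame A owner weight hw hd).HasUniformDelays := by
  intro s hs ho
  obtain ⟨b, hb, h⟩ := hd s hs ho
  change Bornology.IsBounded (A.delays s) ∧ (volume (A.delays s) ≠ 0 → _) ∧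
    (volume (A.delays s) = 0 → _)
  refine ⟨h ▸ Metric.isBounded_Ico 0 b, fun _ => uniformGame_μ hs ho, fun h0 => ?_⟩
  rw [h, Real.volume_Ico, sub_zero, ENNReal.ofReal_eq_zero] at h0
  exact absurd hb h0.not_gt

end Uniform

/-! Clock valuations -/

section Clocks

variable {n : ℕ} (hn : 5 ≤ n)

/-- The clock that measures the total time. -/
def totalClock : Fin n := ⟨0, by omega⟩

/-- The clock that measures the duration of a phase. -/
def phaseClock : Fin n := ⟨1, by omega⟩

/-- The clocks that store numbers; their roles rotate from phase to phase. -/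
def roleClock (i r : Fin 3) : Fin n := ⟨2 + (i + r : Fin 3).1, by omega⟩

/-- The valuation with given values of the total time, of the duration of the phase and of the
three clocks that store numbers. -/
def clocks (i : Fin 3) (a d x y z : ℝ) : Fin n → ℝ := fun c =>
  -- The total clock and all clocks beyond the first five fall under the last case; none of them is
  -- ever reset.
  if c = roleClock hn i 0 then x else if c = roleClock hn i 1 then y
  else if c = roleClock hn i 2 then z else if c = phaseClock hn then d else a

theorem roleClock_injective (i : Fin 3) : Function.Injective (roleClock hn i) := by
  intro r r' h
  simp only [roleClock, Fin.mk.injEq, Nat.add_left_cancel_iff] at h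
  exact add_left_cancel (Fin.ext h)

theorem roleClock_ne_phaseClock (i r : Fin 3) : roleClock hn i r ≠ phaseClock hn := by
  simp only [roleClock, phaseClock, ne_eq, Fin.mk.injEq]; omega

theorem roleClock_ne_totalClock (i r : Fin 3) : roleClock hn i r ≠ totalClock hn := by
  simp only [roleClock, totalClock, ne_eq, Fin.mk.injEq]; omega

theorem phaseClock_ne_totalClock : phaseClock hn ≠ totalClock hn := by
  simp [phaseClock, totalClock]

variable (i : Fin 3) (a d x y z t : ℝ)

theorem clocks_total : clocks hn i a d x y z (totalClock hn) = a := by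
  simp [clocks, (roleClock_ne_totalClock hn i _).symm, (phaseClock_ne_totalClock hn).symm]

theorem clocks_phase : clocks hn i a d x y z (phaseClock hn) = d := by
  simp [clocks, (roleClock_ne_phaseClock hn i _).symm]

theorem clocks_role_zero : clocks hn i a d x y z (roleClock hn i 0) = x := by
  simp [clocks]

theorem clocks_role_two : clocks hn i a d x y z (roleClock hn i 2) = z := by
  simp [clocks, (roleClock_injective hn i).eq_iff]

theorem clocks_delay : (fun c => clocks hn i a d x y z c + t) =
    clocks hn i (a + t) (d + t) (x + t) (y + t) (z + t) := by
  funext c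
  simp only [clocks]
  split_ifs <;> rfl

theorem clocks_reset_none :
    (fun c => if c ∈ (∅ : Finset (Fin n)) then 0 else clocks hn i a d x y z c + t) =
      clocks hn i (a + t) (d + t) (x + t) (y + t) (z + t) := by
  simp [← clocks_delay]

theorem clocks_reset_zero :
    (fun c => if c ∈ ({roleClock hn i 0} : Finset (Fin n)) then 0
        else clocks hn i a d x y z c + t) =
      clocks hn i (a + t) (d + t) 0 (y + t) (z + t) := by
  funext c
  simp only [clocks, Finset.mem_singleton]
  split_ifs <;> rfl

theorem clocks_reset_two :
    (fun c => if c ∈ ({roleClock hn i 2} : Finset (Fin n)) then 0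
        else clocks hn i a d x y z c + t) =
      clocks hn i (a + t) (d + t) (x + t) (y + t) 0 := by
  funext c
  simp only [clocks, Finset.mem_singleton]
  split_ifs with h1 h2 h3 h4 <;> first | rfl | skip
  · exact absurd (roleClock_injective hn i (h1 ▸ h2)) (by decide)
  · exact absurd (roleClock_injective hn i (h1 ▸ h3)) (by decide)

theorem clocks_reset_phase :
    (fun c => if c ∈ ({phaseClock hn} : Finset (Fin n)) then 0
        else clocks hn i a d x y z c + t) =
      clocks hn i (a + t) 0 (x + t) (y + t) (z + t) := by
  funext c
  simp only [clocks, Finset.mem_singleton]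
  split_ifs with h1 h2 h3 h4 <;> first | rfl | skip
  · exact absurd (h2.symm.trans h1) (roleClock_ne_phaseClock hn i _)
  · exact absurd (h3.symm.trans h1) (roleClock_ne_phaseClock hn i _)
  · exact absurd (h4.symm.trans h1) (roleClock_ne_phaseClock hn i _)

/-- A new phase only renames the roles, so no value has to be copied from clock to clock. -/
theorem clocks_rotate : clocks hn (i + 1) a d x y z = clocks hn i a d z x y := by
  have h0 : roleClock hn (i + 1) 0 = roleClock hn i 1 := by simp [roleClock]
  have h1 : roleClock hn (i + 1) 1 = roleClock hn i 2 := by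
    simp only [roleClock, add_assoc]; rfl
  have h2 : roleClock hn (i + 1) 2 = roleClock hn i 0 := by
    simp only [roleClock, add_assoc]; rfl
  funext c
  simp only [clocks, h0, h1, h2]
  have h01 : roleClock hn i 0 ≠ roleClock hn i 1 := fun h =>
    absurd (roleClock_injective hn i h) (by decide)
  have h02 : roleClock hn i 0 ≠ roleClock hn i 2 := fun h =>
    absurd (roleClock_injective hn i h) (by decide)
  by_cases h : c = roleClock hn i 0
  · simp [h, h01, h02]
  · simp [h]

theorem clocks_nonneg {i : Fin 3} {a d x y z : ℝ} (ha : 0 ≤ a) (hd : 0 ≤ d) (hx : 0 ≤ x)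
    (hy : 0 ≤ y) (hz : 0 ≤ z) (c : Fin n) : 0 ≤ clocks hn i a d x y z c := by
  unfold clocks
  split_ifs <;> assumption

end Clocks

/-! The game that simulates an affine machine -/

/-- The locations of the game. In each phase, the players pass through `ctrl`, `mid`, `late` and
`done`; in `mid` and in `done`, Player `□` can go to a location `check`. -/
inductive Loc (M : AffineMachine)
  | ctrl (c : M.Ctrl) (i : Fin 3)
  | mid (t : M.Tr) (i : Fin 3)
  | late (t : M.Tr) (i : Fin 3)
  | done (t : M.Tr) (i : Fin 3)
  | check (b : Bool) (t : M.Tr) (i : Fin 3)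
  | goal
  | sink

/-- The edges of the game. -/
inductive Edge (M : AffineMachine)
  | choose (t : M.Tr) (i : Fin 3)
  | quit (c : M.Ctrl) (i : Fin 3)
  | challenge (b : Bool) (t : M.Tr) (i : Fin 3)
  | pass (t : M.Tr) (i : Fin 3)
  | close (t : M.Tr) (i : Fin 3)
  | quitLate (t : M.Tr) (i : Fin 3)
  | next (t : M.Tr) (i : Fin 3)
  | test (b : Bool) (t : M.Tr) (i : Fin 3) (q : Fin 4 × Bool × Bool)
  | stayGoal
  | staySink

variable (M : AffineMachine)

instance : Finite (Loc M) := by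
  let f : Loc M → (M.Ctrl × Fin 3) ⊕ (Fin 3 × M.Tr × Fin 3) ⊕ (Bool × M.Tr × Fin 3) ⊕ Bool
    | .ctrl c i => .inl (c, i)
    | .mid t i => .inr (.inl (0, t, i))
    | .late t i => .inr (.inl (1, t, i))
    | .done t i => .inr (.inl (2, t, i))
    | .check b t i => .inr (.inr (.inl (b, t, i)))
    | .goal => .inr (.inr (.inr true))
    | .sink => .inr (.inr (.inr false))
  refine Finite.of_injective f fun a b h => ?_
  cases a <;> cases b <;> simp_all [f]

instance : Finite (Edge M) := by
  let f : Edge M → (Fin 5 × M.Tr × Fin 3) ⊕ (M.Ctrl × Fin 3) ⊕ (Bool × M.Tr × Fin 3) ⊕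
      (Bool × M.Tr × Fin 3 × Fin 4 × Bool × Bool) ⊕ Bool
    | .choose t i => .inl (0, t, i)
    | .pass t i => .inl (1, t, i)
    | .close t i => .inl (2, t, i)
    | .quitLate t i => .inl (3, t, i)
    | .next t i => .inl (4, t, i)
    | .quit c i => .inr (.inl (c, i))
    | .challenge b t i => .inr (.inr (.inl (b, t, i)))
    | .test b t i q => .inr (.inr (.inr (.inl (b, t, i, q))))
    | .stayGoal => .inr (.inr (.inr (.inr true)))
    | .staySink => .inr (.inr (.inr (.inr false)))
  refine Finite.of_injective f fun a b h => ?_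
  cases a <;> cases b <;> simp_all [f]

/-! ### The timed automaton and its stochastic tests -/

section Gadget

variable {M} {n : ℕ} (hn : 5 ≤ n)

def Loc.owner : Loc M → Owner
  | .ctrl _ _ | .late _ _ => .diamond
  | .mid _ _ | .done _ _ | .goal | .sink => .box
  | .check _ _ _ => .stochastic

/-- The clock that has the value `0` when a location `check` is entered. -/
def zeroClock (i : Fin 3) : Bool → Fin n
  | false => roleClock hn i 2
  | true => roleClock hn i 0

/-- The bound on the total clock confines the simulation to one time unit. The bound 0 on a clock
that has just been reset forbids any delay in `mid` and `done`. The strict bound in `check` makes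
the set of delays the interval `[0, 1)` on entry. -/
def Loc.inv : Loc M → Constraint n
  | .ctrl _ _ | .late _ _ => [(totalClock hn, .le, 1)]
  | .mid _ i => [(zeroClock hn i false, .le, 0), (totalClock hn, .le, 1)]
  | .done _ i => [(zeroClock hn i true, .le, 0), (totalClock hn, .le, 1)]
  | .check b _ i => [(zeroClock hn i b, .lt, 1)]
  | .goal | .sink => []

/-- The clocks whose values are tested in a location `check`. -/
def testClock (b : Bool) (i : Fin 3) : Fin 4 → Fin n
  | 0 => roleClock hn i 0
  | 1 => phaseClock hn
  | 2 => totalClock hn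
  | 3 => zeroClock hn i b

/-- The weights of the edges from a location `check` to `goal` if the clock is at least `1`, and
if it is less than `1`, respectively. -/
def testWeight (t : M.Tr) : Bool → Fin 4 → ℕ × ℕ
  -- With weights `(p, q)` for a clock of value `v`, the probability is `1/2` iff the sum of the `(p
  -- - q) * v` is half the sum of the `p - q`. The differences are the coefficients of the wanted
  -- relation. Row 3 belongs to a clock with value 0 and only adjusts the constant; the summands 1
  -- keep the weights positive.
  | false, 0 => (M.coef t + 1, 1)
  | false, 1 => (2 * M.scale t + 2 * M.gain t + 1, 2 * M.coef t + 2 * M.drop t + 1)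
  | false, 2 => (M.coef t + 2 * M.scale t + 2 * M.drop t + 1, 2 * M.gain t + 1)
  | false, 3 => (2 * M.coef t + 4 * M.drop t + 1, 4 * M.gain t + 1)
  | true, 0 => (1, 1)
  | true, 1 => (2, 1)
  | true, 2 => (2, 1)
  | true, 3 => (1, 1)

namespace Edge

def src : Edge M → Loc M
  | .choose t i => .ctrl (M.src t) i
  | .quit c i => .ctrl c i
  | .challenge false t i => .mid t i
  | .challenge true t i => .done t i
  | .pass t i => .mid t i
  | .close t i => .late t i
  | .quitLate t i => .late t i
  | .next t i => .done t i
  | .test b t i _ => .check b t i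
  | .stayGoal => .goal
  | .staySink => .sink

def tgt : Edge M → Loc M
  | .choose t i => .mid t i
  | .quit _ _ => .sink
  | .challenge b t i => .check b t i
  | .pass t i => .late t i
  | .close t i => .done t i
  | .quitLate _ _ => .sink
  | .next t i => match M.dst t with
    | some c => .ctrl c (i + 1)
    -- At an accepting transition both moves of Player `□` lead to the same test, so it cannot be
    -- avoided.
    | none => .check true t i
  | .test _ _ _ (_, _, toGoal) => if toGoal then .goal else .sink
  | .stayGoal => .goal
  | .staySink => .sink

def guard : Edge M → Constraint n
  | .test b _ i (c, large, _) => [(testClock hn b i c, if large then .ge else .lt, 1)]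
  | _ => []

def resets : Edge M → List (Fin n)
  | .choose _ i => [zeroClock hn i false]
  | .close _ i => [zeroClock hn i true]
  | .next t _ => match M.dst t with
    | some _ => [phaseClock hn]
    | none => []
  | _ => []

/-- The weights of the edges to `goal` and to `sink` are exchanged when the clock reaches 1, so the
enabled total is independent of the delay. -/
def weight : Edge M → ℕ
  | .test b t _ (c, large, toGoal) =>
    if large = toGoal then (testWeight t b c).1 else (testWeight t b c).2
  | _ => 1

theorem weight_pos (e : Edge M) : 0 < e.weight := by
  rcases e with _ | _ | _ | _ | _ | _ | _ | ⟨b, t, i, c, l, g⟩ | _ | _ <;>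
    first | exact one_pos | skip
  change 0 < if l = g then (testWeight t b c).1 else (testWeight t b c).2
  split_ifs <;> cases b <;> fin_cases c <;> simp [testWeight]

end Edge

variable {m k : ℕ} (eL : Loc M ≃ Fin m) (eE : Edge M ≃ Fin k)

/-- The timed automaton that simulates an affine machine. -/
def machineAutomaton : TimedAutomaton m n k where
  src e := eL (eE.symm e).src
  guard e := (eE.symm e).guard hn
  reset e := ((eE.symm e).resets hn).toFinset
  tgt e := eL (eE.symm e).tgt
  inv l := (eL.symm l).inv hn

theorem isState_iff (l : Loc M) (ν : Fin n → ℝ) :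
    (machineAutomaton hn eL eE).IsState (eL l, ν) ↔ (∀ x, 0 ≤ ν x) ∧ Sat ν (l.inv hn) := by
  simp [TimedAutomaton.IsState, machineAutomaton]

theorem succ_eq (l : Loc M) (ν : Fin n → ℝ) (t : ℝ) (e : Edge M) :
    (machineAutomaton hn eL eE).succ (eL l, ν) (t, eE e) =
      (eL e.tgt, fun x => if x ∈ (e.resets hn).toFinset then 0 else ν x + t) := by
  simp [TimedAutomaton.succ, machineAutomaton]

theorem trans_edge_iff (l : Loc M) (ν : Fin n → ℝ) (t : ℝ) (e : Edge M) :
    (machineAutomaton hn eL eE).Trans (eL l, ν) (t, eE e) ↔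
      ((∀ x, 0 ≤ ν x) ∧ Sat ν (l.inv hn)) ∧ e.src = l ∧ 0 ≤ t ∧
        Sat (fun x => ν x + t) (l.inv hn) ∧ Sat (fun x => ν x + t) (e.guard hn) ∧
        Sat (fun x => if x ∈ (e.resets hn).toFinset then 0 else ν x + t) (e.tgt.inv hn) := by
  rw [TimedAutomaton.trans_iff, succ_eq, isState_iff, isState_iff]
  simp only [machineAutomaton, State.delay, Equiv.symm_apply_apply, EmbeddingLike.apply_eq_iff_eq]
  constructor
  · rintro ⟨h1, h2, h3, h4, h5, -, h6⟩
    exact ⟨h1, h2, h3, h4, h5, h6⟩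
  · rintro ⟨h1, h2, h3, h4, h5, h6⟩
    refine ⟨h1, h2, h3, h4, h5, fun x => ?_, h6⟩
    split_ifs
    · exact le_rfl
    · exact add_nonneg (h1.1 x) h3

theorem sat_nil (ν : Fin n → ℝ) : Sat ν [] := by simp [Sat]

theorem sat_cons (ν : Fin n → ℝ) (a : Fin n × Cmp × ℕ) (g : Constraint n) :
    Sat ν (a :: g) ↔ a.2.1.Holds (ν a.1) a.2.2 ∧ Sat ν g := by
  simp [Sat]

/-- An edge that can be taken without a delay in every state of a location. -/
def defaultEdge : Loc M → Edge M
  | .ctrl c i => .quit c i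
  | .mid t i => .challenge false t i
  | .late t i => .quitLate t i
  | .done t i => .challenge true t i
  -- The clock number 3 is below 1 by the invariant, so this guard always holds.
  | .check b t i => .test b t i (3, false, true)
  | .goal => .stayGoal
  | .sink => .staySink

theorem trans_defaultEdge {l : Loc M} {ν : Fin n → ℝ}
    (h : (machineAutomaton hn eL eE).IsState (eL l, ν)) :
    (machineAutomaton hn eL eE).Trans (eL l, ν) (0, eE (defaultEdge l)) := by
  rw [isState_iff] at h
  rw [trans_edge_iff]
  refine ⟨h, ?_, le_rfl, by simpa using h.2, ?_, ?_⟩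
  · cases l <;> rfl
  · cases l <;> first | exact sat_nil _ | skip
    simpa [defaultEdge, Edge.guard, testClock, Loc.inv] using h.2
  · have h2 := h.2
    cases l <;> simp [defaultEdge, Edge.tgt, Edge.resets, Loc.inv, sat_nil] at * <;>
      simp only [sat_cons, Cmp.Holds] at * <;>
      exact ⟨by push_cast at *; linarith [h2.1], sat_nil _⟩

/-- The test of the clock number 3 for being small never blocks, so only the invariant limits the
delay. This covers all states of `check`, also those that are not reachable. -/
theorem delays_check {b : Bool} {t : M.Tr} {i : Fin 3} {ν : Fin n → ℝ}
    (h : (machineAutomaton hn eL eE).IsState (eL (.check b t i), ν)) :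
    (machineAutomaton hn eL eE).delays (eL (.check b t i), ν) =
      Set.Ico 0 (1 - ν (zeroClock hn i b)) := by
  rw [isState_iff] at h
  ext u
  simp only [TimedAutomaton.delays, TimedAutomaton.delaysVia, Set.mem_iUnion, Set.mem_ofPred_eq,
    Set.mem_Ico]
  constructor
  · rintro ⟨e, he⟩
    obtain ⟨e, rfl⟩ := eE.surjective e
    rw [trans_edge_iff] at he
    have := he.2.2.2.1
    simp only [Loc.inv, sat_cons, Cmp.Holds] at this
    push_cast at this
    exact ⟨he.2.2.1, by linarith [this.1]⟩
  · rintro ⟨h1, h2⟩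
    have hs : Sat (fun x => ν x + u) [(zeroClock hn i b, .lt, 1)] := by
      rw [sat_cons]
      exact ⟨by simp only [Cmp.Holds]; push_cast; linarith, sat_nil _⟩
    refine ⟨eE (.test b t i (3, false, true)), ?_⟩
    rw [trans_edge_iff]
    exact ⟨h, rfl, h1, hs, hs, sat_nil _⟩

/-- The game that simulates an affine machine. -/
def machineGame : Game m n k :=
  uniformGame (machineAutomaton hn eL eE) (fun l => (eL.symm l).owner)
    (fun e => (eE.symm e).weight) (fun e _ => (eE.symm e).weight_pos) (fun s hs ho => by
      obtain ⟨l, ν⟩ := s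
      obtain ⟨l, rfl⟩ := eL.surjective l
      cases l <;> simp [Loc.owner] at ho
      refine ⟨_, ?_, delays_check hn eL eE hs⟩
      rw [isState_iff] at hs
      have := hs.2
      simp only [Loc.inv, sat_cons, Cmp.Holds] at this
      push_cast at this
      linarith [this.1])

theorem machineGame_nonBlocking : (machineGame hn eL eE).NonBlocking := by
  rintro ⟨l, ν⟩ hs
  obtain ⟨l, rfl⟩ := eL.surjective l
  exact ⟨0, Set.mem_iUnion.2 ⟨_, trans_defaultEdge hn eL eE hs⟩⟩

theorem machineGame_owner (l : Loc M) : (machineGame hn eL eE).owner (eL l) = l.owner := by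
  simp [machineGame, uniformGame]

end Gadget

/-! The probability to reach `goal` from a location `check` -/

section Check

variable {M : AffineMachine} {n m k : ℕ} {hn : 5 ≤ n} {eL : Loc M ≃ Fin m} {eE : Edge M ≃ Fin k}

theorem trans_tgt {l : Loc M} {s : State m n} {a : Step k} (hs : s.1 = eL l)
    (h : (machineGame hn eL eE).Trans s a) :
    ∃ e : Edge M, a.2 = eE e ∧ e.src = l ∧ ((machineGame hn eL eE).succ s a).1 = eL e.tgt := by
  obtain ⟨l', ν⟩ := s
  obtain ⟨t, e⟩ := a
  obtain ⟨e, rfl⟩ := eE.surjective e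
  simp only at hs
  subst hs
  have h' := (trans_edge_iff hn eL eE l ν t e).1 h
  exact ⟨e, rfl, h'.2.1, congrArg Prod.fst (succ_eq hn eL eE l ν t e)⟩

theorem goal_of_trans {s : State m n} {a : Step k} (hs : s.1 = eL .goal)
    (h : (machineGame hn eL eE).Trans s a) : ((machineGame hn eL eE).succ s a).1 = eL .goal := by
  obtain ⟨e, -, he, ht⟩ := trans_tgt hs h
  rw [ht]
  rcases e with _ | _ | ⟨_ | _, _, _⟩ | _ | _ | _ | _ | _ | _ | _ <;> simp_all [Edge.src, Edge.tgt]

theorem sink_of_trans {s : State m n} {a : Step k} (hs : s.1 = eL .sink)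
    (h : (machineGame hn eL eE).Trans s a) : ((machineGame hn eL eE).succ s a).1 = eL .sink := by
  obtain ⟨e, -, he, ht⟩ := trans_tgt hs h
  rw [ht]
  rcases e with _ | _ | ⟨_ | _, _, _⟩ | _ | _ | _ | _ | _ | _ | _ <;> simp_all [Edge.src, Edge.tgt]

theorem goal_or_sink_of_trans {s : State m n} {a : Step k} {b : Bool} {t : M.Tr} {i : Fin 3}
    (hs : s.1 = eL (.check b t i)) (h : (machineGame hn eL eE).Trans s a) :
    ((machineGame hn eL eE).succ s a).1 = eL .goal ∨
      ((machineGame hn eL eE).succ s a).1 = eL .sink := by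
  obtain ⟨e, -, he, ht⟩ := trans_tgt hs h
  rw [ht]
  rcases e with _ | _ | ⟨_ | _, _, _⟩ | _ | _ | _ | _ | ⟨_, _, _, _, _, _ | _⟩ | _ | _ <;>
    simp_all [Edge.src, Edge.tgt]

variable {s : State m n} {ω : ℕ → Step k}

open Game (firstSteps)

/-- The location after `j` steps. -/
def locAfter (hn : 5 ≤ n) (eL : Loc M ≃ Fin m) (eE : Edge M ≃ Fin k) (s : State m n)
    (ω : ℕ → Step k) (j : ℕ) : Fin m :=
  ((machineGame hn eL eE).stateAfter s j (firstSteps j ω)).1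

theorem locAfter_goal (hr : ∀ j, (machineGame hn eL eE).IsRun s j (firstSteps j ω)) {i j : ℕ}
    (hij : i ≤ j) (hi : locAfter hn eL eE s ω i = eL .goal) :
    locAfter hn eL eE s ω j = eL .goal := by
  induction j, hij using Nat.le_induction with
  | base => exact hi
  | succ j hij ih => exact goal_of_trans ih (hr (j + 1)).2

theorem locAfter_sink (hr : ∀ j, (machineGame hn eL eE).IsRun s j (firstSteps j ω)) {i j : ℕ}
    (hij : i ≤ j) (hi : locAfter hn eL eE s ω i = eL .sink) :
    locAfter hn eL eE s ω j = eL .sink := by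
  induction j, hij using Nat.le_induction with
  | base => exact hi
  | succ j hij ih => exact sink_of_trans ih (hr (j + 1)).2

/-- From `check` one step leads to `goal` or `sink`, both absorbing, so this step decides. The time
bound is respected since the delay in `check` is less than 1. -/
theorem visitsWithin_iff_of_check (hr : ∀ j, (machineGame hn eL eE).IsRun s j (firstSteps j ω))
    {j : ℕ} {b : Bool} {t : M.Tr} {i : Fin 3}
    (hj : locAfter hn eL eE s ω j = eL (.check b t i))
    (ht : ∑ i ∈ Finset.range j, (ω i).1 ≤ 4) :
    (machineGame hn eL eE).VisitsWithin s {eL .goal} 5 ω ↔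
      (machineGame hn eL eE).tgt (ω j).2 = eL .goal := by
  have hsucc : locAfter hn eL eE s ω (j + 1) = (machineGame hn eL eE).tgt (ω j).2 := rfl
  have htr : (machineGame hn eL eE).Trans ((machineGame hn eL eE).stateAfter s j
    (firstSteps j ω)) (ω j) := (hr (j + 1)).2
  rw [← hsucc]
  constructor
  · rintro ⟨j', hj', -⟩
    have hj' : locAfter hn eL eE s ω j' = eL .goal := hj'
    have hlt : j + 1 ≤ j' := by
      by_contra hlt
      have := locAfter_goal hr (by omega : j' ≤ j) hj'
      rw [hj] at this
      exact absurd (eL.injective this) (by simp)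
    refine (goal_or_sink_of_trans hj htr).resolve_right fun hsink => ?_
    have := locAfter_sink hr hlt hsink
    rw [hj'] at this
    exact absurd (eL.injective this) (by simp)
  · intro hg
    refine ⟨j + 1, hg, ?_⟩
    have hd : (ω j).1 ∈ (machineAutomaton hn eL eE).delays
        ((machineGame hn eL eE).stateAfter s j (firstSteps j ω)) :=
      Set.mem_iUnion.2 ⟨(ω j).2, htr⟩
    have hst := htr.1
    rw [← Prod.mk.eta (p := (machineGame hn eL eE).stateAfter s j (firstSteps j ω))] at hd hst
    rw [show ((machineGame hn eL eE).stateAfter s j (firstSteps j ω)).1 = _ from hj] at hd hst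
    rw [delays_check hn eL eE hst] at hd
    have h0 := hst.1 (zeroClock hn i b)
    rw [Finset.sum_range_succ]
    have := hd.2
    simp only at h0
    linarith

theorem enabled_test_iff {b : Bool} {t : M.Tr} {i : Fin 3} {ν : Fin n → ℝ} {u : ℝ}
    (hs : (machineAutomaton hn eL eE).IsState (eL (.check b t i), ν))
    (hu : u ∈ Set.Ico 0 (1 - ν (zeroClock hn i b))) (c : Fin 4) (large toGoal : Bool) :
    (machineGame hn eL eE).Enabled (State.delay (eL (.check b t i), ν) u)
        (eE (.test b t i (c, large, toGoal))) ↔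
      (large = true ↔ 1 ≤ ν (testClock hn b i c) + u) := by
  have hs' := (isState_iff hn eL eE _ _).1 hs
  have hz : Sat (fun x => ν x + u) ((Loc.check b t i).inv hn) := by
    rw [Loc.inv, sat_cons]
    refine ⟨?_, sat_nil _⟩
    simp only [Cmp.Holds]; push_cast; linarith [hu.2]
  have hnn : ∀ x, 0 ≤ ν x + u := fun x => add_nonneg (hs'.1 x) hu.1
  refine (trans_edge_iff hn eL eE (.check b t i) (fun x => ν x + u) 0
    (.test b t i (c, large, toGoal))).trans ?_
  have htgt : ∀ ν' : Fin n → ℝ,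
      Sat ν' ((Edge.test b t i (c, large, toGoal)).tgt.inv hn) := by
    intro ν'; cases toGoal <;> exact sat_nil _
  simp only [htgt, and_true, add_zero, hz, hnn, Edge.src, implies_true, true_and, le_refl,
    Edge.guard, sat_cons, sat_nil]
  cases large <;> simp [Cmp.Holds]

theorem not_enabled_of_ne_test {b : Bool} {t : M.Tr} {i : Fin 3} {ν : Fin n → ℝ} {u : ℝ}
    {e : Edge M} (he : ∀ q, e ≠ .test b t i q) :
    ¬ (machineGame hn eL eE).Enabled (State.delay (eL (.check b t i), ν) u) (eE e) := by
  intro h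
  obtain ⟨e', h1, h2, -⟩ := trans_tgt (l := .check b t i) rfl h
  obtain rfl := eE.injective h1
  rcases e with _ | _ | ⟨_ | _, _, _⟩ | _ | _ | _ | _ | _ | _ | _ <;> cases h2
  exact he _ rfl

/-- For each tested clock exactly one of the two comparisons with 1 is enabled. The function `F` is
general because the sum is needed both for the total weight and for the mass of the edges to `goal`.
-/
theorem sum_enabledWeight {R : Type*} [AddCommMonoid R] (F : ℕ → Fin k → R) (hF : ∀ e, F 0 e = 0)
    {b : Bool} {t : M.Tr} {i : Fin 3} {ν : Fin n → ℝ} {u : ℝ}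
    (hs : (machineAutomaton hn eL eE).IsState (eL (.check b t i), ν))
    (hu : u ∈ Set.Ico 0 (1 - ν (zeroClock hn i b))) :
    ∑ e, F ((machineGame hn eL eE).enabledWeight (State.delay (eL (.check b t i), ν) u) e) e =
      ∑ c : Fin 4, if 1 ≤ ν (testClock hn b i c) + u then
        F (testWeight t b c).1 (eE (.test b t i (c, true, true))) +
          F (testWeight t b c).2 (eE (.test b t i (c, true, false)))
        else F (testWeight t b c).2 (eE (.test b t i (c, false, true))) +
          F (testWeight t b c).1 (eE (.test b t i (c, false, false))) := by
  rw [← Fintype.sum_of_injective (fun q => eE (.test b t i q))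
    (fun q q' h => by simpa using h)
    (fun q => F ((machineGame hn eL eE).enabledWeight (State.delay (eL (.check b t i), ν) u)
      (eE (.test b t i q))) (eE (.test b t i q))) _ ?_ fun _ => rfl]
  · rw [Fintype.sum_prod_type]
    refine Finset.sum_congr rfl fun c _ => ?_
    have hw (large toGoal : Bool) : (machineGame hn eL eE).weight
        (eE (.test b t i (c, large, toGoal))) =
        if large = toGoal then (testWeight t b c).1 else (testWeight t b c).2 := by
      simp [machineGame, uniformGame, Edge.weight]
    simp only [Fintype.sum_prod_type, Fintype.sum_bool, Game.enabledWeight,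
      enabled_test_iff hs hu, hw]
    by_cases h : 1 ≤ ν (testClock hn b i c) + u <;> simp [h, hF]
  · intro e he
    obtain ⟨e, rfl⟩ := eE.surjective e
    rw [Game.enabledWeight, if_neg (not_enabled_of_ne_test fun q hq => he ⟨q, by rw [hq]⟩), hF]

/-- The sum of the weights of the edges that are enabled in a location `check`. -/
def checkWeight (t : M.Tr) (b : Bool) : ℕ := ∑ c : Fin 4, ((testWeight t b c).1 + (testWeight t b c).2)

theorem checkWeight_pos (t : M.Tr) (b : Bool) : 0 < checkWeight t b := by
  unfold checkWeight
  cases b <;> simp [Fin.sum_univ_four, testWeight]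

theorem edgeLaw_goal {b : Bool} {t : M.Tr} {i : Fin 3} {ν : Fin n → ℝ} {u : ℝ}
    (hs : (machineAutomaton hn eL eE).IsState (eL (.check b t i), ν))
    (hu : u ∈ Set.Ico 0 (1 - ν (zeroClock hn i b))) (e₀ : Fin k) :
    (machineGame hn eL eE).edgeLaw (State.delay (eL (.check b t i), ν) u) e₀
        {e | (machineGame hn eL eE).tgt e = eL .goal} =
      (∑ c : Fin 4, if 1 ≤ ν (testClock hn b i c) + u then ((testWeight t b c).1 : ℝ≥0∞)
        else (testWeight t b c).2) / checkWeight t b := by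
  have hW : (machineGame hn eL eE).totalWeight (State.delay (eL (.check b t i), ν) u) =
      checkWeight t b := by
    refine (sum_enabledWeight (fun w _ => w) (fun _ => rfl) hs hu).trans ?_
    refine Finset.sum_congr rfl fun c _ => ?_
    split_ifs
    · rfl
    · exact add_comm _ _
  rw [Game.edgeLaw, hW, if_neg (checkWeight_pos t b).ne', Measure.coe_finsetSum, Finset.sum_apply]
  simp only [Measure.smul_apply, smul_eq_mul]
  rw [sum_enabledWeight (fun w e => ((w : ℝ≥0∞) / (checkWeight t b : ℝ≥0∞)) *
    Measure.dirac e {e | (machineGame hn eL eE).tgt e = eL .goal}) (by simp) hs hu,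
    div_eq_mul_inv, Finset.sum_mul]
  refine Finset.sum_congr rfl fun c _ => ?_
  have htgt (large toGoal : Bool) : (machineGame hn eL eE).tgt
      (eE (.test b t i (c, large, toGoal))) = eL .goal ↔ toGoal = true := by
    change eL (eE.symm (eE _)).tgt = _ ↔ _
    rw [Equiv.symm_apply_apply]
    cases toGoal <;> simp [Edge.tgt]
  simp only [Measure.dirac_apply' _ (Set.toFinite _).measurableSet, Set.indicator_apply,
    Set.mem_ofPred_eq, htgt, if_true, Bool.false_eq_true, if_false, mul_one, mul_zero, add_zero,
    Pi.one_apply]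
  split_ifs <;> rfl

/-- This is how clock values become probabilities: a clock with value `v` is at least 1 after the
delay for a set of delays of measure `v`. -/
theorem lintegral_threshold {v : ℝ} (hv : 0 ≤ v ∧ v ≤ 1) (p q : ℕ) :
    ∫⁻ u in Set.Ico (0 : ℝ) 1, (if 1 ≤ v + u then (p : ℝ≥0∞) else q) =
      ENNReal.ofReal (p * v + q * (1 - v)) := by
  have h1 : (fun u : ℝ => if 1 ≤ v + u then (p : ℝ≥0∞) else q) =
      fun u => (Set.Ici (1 - v)).indicator (fun _ => (p : ℝ≥0∞)) u +
        (Set.Iio (1 - v)).indicator (fun _ => (q : ℝ≥0∞)) u := by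
    funext u
    by_cases h : 1 ≤ v + u
    · have h' : 1 - v ≤ u := by linarith
      simp [h, h']
    · have h' : u < 1 - v := by linarith
      simp [h, h', h'.not_ge]
  have h2 : Set.Ici (1 - v) ∩ Set.Ico 0 1 = Set.Ico (1 - v) 1 := by
    ext u; simp only [Set.mem_inter_iff, Set.mem_Ici, Set.mem_Ico]
    constructor
    · rintro ⟨h, -, h'⟩; exact ⟨h, h'⟩
    · rintro ⟨h, h'⟩; exact ⟨h, by linarith, h'⟩
  have h3 : Set.Iio (1 - v) ∩ Set.Ico 0 1 = Set.Ico 0 (1 - v) := by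
    ext u; simp only [Set.mem_inter_iff, Set.mem_Iio, Set.mem_Ico]
    constructor
    · rintro ⟨h, h', -⟩; exact ⟨h', h⟩
    · rintro ⟨h, h'⟩; exact ⟨h', h, by linarith⟩
  rw [h1, lintegral_add_left (measurable_const.indicator measurableSet_Ici),
    lintegral_indicator_const measurableSet_Ici, lintegral_indicator_const measurableSet_Iio,
    Measure.restrict_apply measurableSet_Ici, Measure.restrict_apply measurableSet_Iio, h2, h3,
    Real.volume_Ico, Real.volume_Ico, ENNReal.ofReal_add (by have := hv.1; positivity)
      (mul_nonneg (Nat.cast_nonneg _) (by linarith [hv.2])),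
    ENNReal.ofReal_mul (Nat.cast_nonneg _), ENNReal.ofReal_mul (Nat.cast_nonneg _),
    ENNReal.ofReal_natCast, ENNReal.ofReal_natCast]
  simp

/-- The probability of the edges to `goal`. -/
def checkValue (t : M.Tr) (b : Bool) (v : Fin 4 → ℝ) : ℝ :=
  (∑ c, ((testWeight t b c).1 * v c + (testWeight t b c).2 * (1 - v c))) / checkWeight t b

variable {σ : (machineGame hn eL eE).Strategy .diamond} {τ : (machineGame hn eL eE).Strategy .box}

/-- The clock with value 0 makes the delay uniform on `[0, 1)`. As the total weight is constant, the
integral splits into one threshold integral per clock. -/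
theorem stochasticKernel_goal {j : ℕ} {h : Fin j → Step k} {b : Bool} {t : M.Tr} {i : Fin 3}
    {ν : Fin n → ℝ} (hst : (machineGame hn eL eE).stateAfter s j h = (eL (.check b t i), ν))
    (hs : (machineAutomaton hn eL eE).IsState (eL (.check b t i), ν))
    (hz : ν (zeroClock hn i b) = 0) (hv : ∀ c, ν (testClock hn b i c) ≤ 1) :
    (Game.stochasticKernel s σ j h {a | (machineGame hn eL eE).tgt a.2 = eL .goal}).toReal =
      checkValue t b fun c => ν (testClock hn b i c) := by
  have hB : MeasurableSet {e : Fin k | (machineGame hn eL eE).tgt e = eL .goal} :=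
    (Set.toFinite _).measurableSet
  have hμ : (machineGame hn eL eE).μ (eL (.check b t i), ν) = volume.restrict (Set.Ico 0 1) := by
    refine (uniformGame_μ hs (by simp [Loc.owner])).trans ?_
    rw [delays_check hn eL eE hs, hz, sub_zero, ProbabilityTheory.cond]
    simp
  have hv' : ∀ c, 0 ≤ ν (testClock hn b i c) ∧ ν (testClock hn b i c) ≤ 1 :=
    fun c => ⟨hs.1 _, hv c⟩
  unfold Game.stochasticKernel
  have hB' : MeasurableSet {a : Step k | (machineGame hn eL eE).tgt a.2 = eL .goal} :=
    measurable_snd hB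
  rw [Kernel.compProd_apply hB', Kernel.comap_apply, hst, hμ]
  have : ∫⁻ u in Set.Ico (0 : ℝ) 1, Game.edgeKernel s σ j (h, u)
        (Prod.mk u ⁻¹' {a : Step k | (machineGame hn eL eE).tgt a.2 = eL .goal}) =
      ∫⁻ u in Set.Ico (0 : ℝ) 1, (∑ c : Fin 4, if 1 ≤ ν (testClock hn b i c) + u then
        ((testWeight t b c).1 : ℝ≥0∞) else (testWeight t b c).2) / checkWeight t b := by
    refine setLIntegral_congr_fun measurableSet_Ico fun u hu => ?_
    change (machineGame hn eL eE).edgeLaw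
      (((machineGame hn eL eE).stateAfter s j h).delay u) _ _ = _
    rw [hst]
    exact edgeLaw_goal hs (by rwa [hz, sub_zero]) _
  rw [this]
  simp only [div_eq_mul_inv]
  have hm : ∀ c, Measurable fun u : ℝ => if 1 ≤ ν (testClock hn b i c) + u then
      ((testWeight t b c).1 : ℝ≥0∞) else (testWeight t b c).2 := fun c =>
    Measurable.ite (measurableSet_le measurable_const (by fun_prop)) measurable_const
      measurable_const
  rw [lintegral_mul_const _ (Finset.measurable_sum _ fun c _ => hm c),
    lintegral_finsetSum _ fun c _ => hm c]
  simp only [lintegral_threshold (hv' _)]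
  have hnn : ∀ c, 0 ≤ ((testWeight t b c).1 : ℝ) * ν (testClock hn b i c) +
      (testWeight t b c).2 * (1 - ν (testClock hn b i c)) := fun c =>
    add_nonneg (mul_nonneg (Nat.cast_nonneg _) (hv' c).1)
      (mul_nonneg (Nat.cast_nonneg _) (by linarith [(hv' c).2]))
  rw [← ENNReal.ofReal_sum_of_nonneg fun c _ => hnn c, ENNReal.toReal_mul,
    ENNReal.toReal_ofReal (Finset.sum_nonneg fun c _ => hnn c), ENNReal.toReal_inv,
    ENNReal.toReal_natCast, checkValue, div_eq_mul_inv]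

/-- The probability of a visit to `goal` after a location `check` has been entered. -/
theorem visit_probability_of_check (hs : (machineGame hn eL eE).IsState s) {j : ℕ}
    {h : Fin j → Step k} (hf : Game.Follows s σ τ j h) {b : Bool} {t : M.Tr} {i : Fin 3}
    {ν : Fin n → ℝ} (hst : (machineGame hn eL eE).stateAfter s j h = (eL (.check b t i), ν))
    (hz : ν (zeroClock hn i b) = 0) (hv : ∀ c, ν (testClock hn b i c) ≤ 1)
    (ht : ∑ i, (h i).1 ≤ 4) :
    (Game.runMeasure s σ τ).real {ω | (machineGame hn eL eE).VisitsWithin s {eL .goal} 5 ω} =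
      checkValue t b fun c => ν (testClock hn b i c) := by
  have hr := hf.isRun hs
  have hs' : (machineAutomaton hn eL eE).IsState (eL (.check b t i), ν) := by
    rw [← hst]; exact hr.isState
  have hae : ∀ᵐ ω ∂Game.runMeasure s σ τ,
      (machineGame hn eL eE).VisitsWithin s {eL .goal} 5 ω ↔
        (machineGame hn eL eE).tgt (ω j).2 = eL .goal := by
    filter_upwards [hf.ae_firstSteps, Game.ae_isRun hs] with ω h1 h2
    refine visitsWithin_iff_of_check h2 (b := b) (t := t) (i := i) ?_ ?_
    · rw [locAfter, h1, hst]
    · rw [Finset.sum_range]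
      rw [← h1] at ht
      exact ht
  have hB : MeasurableSet {a : Step k | (machineGame hn eL eE).tgt a.2 = eL .goal} :=
    measurable_snd (Set.toFinite {e | (machineGame hn eL eE).tgt e = eL .goal}).measurableSet
  have hae' : {ω | (machineGame hn eL eE).VisitsWithin s {eL .goal} 5 ω}
      =ᵐ[Game.runMeasure s σ τ]
      {ω | ω j ∈ {a : Step k | (machineGame hn eL eE).tgt a.2 = eL .goal}} :=
    hae.mono fun ω hω => propext hω
  rw [Measure.real, measure_congr hae',
    Game.map_step_of_ae_firstSteps hf.ae_firstSteps hB, Game.nextKernel_of_stochastic,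
    stochasticKernel_goal hst hs' hz hv]
  rw [hst, machineGame_owner]
  rfl

end Check

/-! ### Tests, moves and strategies in a single phase -/

section Dynamics

variable {M : AffineMachine} {n m k : ℕ} {hn : 5 ≤ n} {eL : Loc M ≃ Fin m} {eE : Edge M ≃ Fin k}

/-! The values of the checks -/

/-- For `a = 1 - r + δ`, `d = δ` and `x = r * (2 * v + 1) + δ` the relation reads `scale * (1 - 2 *
δ / r) + drop = coef * v + gain`: the first delay `δ` encodes the correct `v' = 1 - 2 * δ / r`. -/
theorem checkValue_false_iff (t : M.Tr) (i : Fin 3) (a d x y : ℝ) :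
    checkValue t false (fun c => clocks hn i a d x y 0 (testClock hn false i c)) = 1 / 2 ↔
      M.coef t * x + (2 * M.scale t + 2 * (M.gain t - M.drop t) - 2 * M.coef t) * d +
        (M.coef t + 2 * M.scale t - 2 * (M.gain t - M.drop t)) * a =
      M.coef t + 2 * M.scale t - 2 * (M.gain t - M.drop t) := by
  have hW : (0 : ℝ) < checkWeight t false := by exact_mod_cast checkWeight_pos t false
  rw [checkValue, div_eq_iff hW.ne']
  simp only [checkWeight, Fin.sum_univ_four, testWeight, testClock, zeroClock, clocks_role_zero,
    clocks_phase, clocks_total, clocks_role_two]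
  push_cast
  constructor <;> intro h <;> linear_combination h

/-- If the phase began with `r` time units left, then `a = 1 - r + d`, and the relation says `d = r
/ 2`. -/
theorem checkValue_true_iff (t : M.Tr) (i : Fin 3) (a d y z : ℝ) :
    checkValue t true (fun c => clocks hn i a d 0 y z (testClock hn true i c)) = 1 / 2 ↔
      d + a = 1 := by
  have hW : (0 : ℝ) < checkWeight t true := by exact_mod_cast checkWeight_pos t true
  rw [checkValue, div_eq_iff hW.ne']
  simp only [checkWeight, Fin.sum_univ_four, testWeight, testClock, zeroClock, clocks_role_zero,
    clocks_phase, clocks_total]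
  push_cast
  constructor <;> intro h <;> linear_combination h

theorem clocks_testClock_le {b : Bool} {i : Fin 3} {a d x y z : ℝ} (ha : a ≤ 1) (hd : d ≤ 1)
    (hx : x ≤ 1) (hz : z ≤ 1) (c : Fin 4) : clocks hn i a d x y z (testClock hn b i c) ≤ 1 := by
  fin_cases c
  · simpa [testClock, clocks_role_zero] using hx
  · simpa [testClock, clocks_phase] using hd
  · simpa [testClock, clocks_total] using ha
  · cases b
    · simpa [testClock, zeroClock, clocks_role_two] using hz
    · simpa [testClock, zeroClock, clocks_role_zero] using hx

/-! The effect of the edges -/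

section Succ

variable (i : Fin 3) (a d x y z u : ℝ) (l : Loc M) (t : M.Tr)

theorem succ_choose : (machineGame hn eL eE).succ (eL l, clocks hn i a d x y z)
    (u, eE (.choose t i)) =
      (eL (.mid t i), clocks hn i (a + u) (d + u) (x + u) (y + u) 0) :=
  (succ_eq hn eL eE _ _ _ _).trans (congrArg (Prod.mk _) (clocks_reset_two hn i a d x y z u))

theorem succ_challenge (b : Bool) : (machineGame hn eL eE).succ (eL l, clocks hn i a d x y z)
    (0, eE (.challenge b t i)) = (eL (.check b t i), clocks hn i a d x y z) :=
  (succ_eq hn eL eE _ _ _ _).trans (congrArg (Prod.mk _)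
    ((clocks_reset_none hn i a d x y z 0).trans (by simp only [add_zero])))

theorem succ_pass : (machineGame hn eL eE).succ (eL l, clocks hn i a d x y z)
    (0, eE (.pass t i)) = (eL (.late t i), clocks hn i a d x y z) :=
  (succ_eq hn eL eE _ _ _ _).trans (congrArg (Prod.mk _)
    ((clocks_reset_none hn i a d x y z 0).trans (by simp only [add_zero])))

theorem succ_close : (machineGame hn eL eE).succ (eL l, clocks hn i a d x y z)
    (u, eE (.close t i)) =
      (eL (.done t i), clocks hn i (a + u) (d + u) 0 (y + u) (z + u)) :=
  (succ_eq hn eL eE _ _ _ _).trans (congrArg (Prod.mk _) (clocks_reset_zero hn i a d x y z u))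

theorem succ_next_some {t : M.Tr} {c : M.Ctrl} (ht : M.dst t = some c) :
    (machineGame hn eL eE).succ (eL l, clocks hn i a d 0 y z) (0, eE (.next t i)) =
      (eL (.ctrl c (i + 1)), clocks hn (i + 1) a 0 y z 0) := by
  refine (succ_eq hn eL eE _ _ _ _).trans ?_
  simp only [Edge.tgt, Edge.resets, ht]
  refine congrArg (Prod.mk _) ((clocks_reset_phase hn i a d 0 y z 0).trans ?_)
  rw [clocks_rotate]
  simp only [add_zero]

theorem succ_next_none {t : M.Tr} (ht : M.dst t = none) :
    (machineGame hn eL eE).succ (eL l, clocks hn i a d x y z) (0, eE (.next t i)) =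
      (eL (.check true t i), clocks hn i a d x y z) := by
  refine (succ_eq hn eL eE _ _ _ _).trans ?_
  simp only [Edge.tgt, Edge.resets, ht]
  exact congrArg (Prod.mk _)
    ((clocks_reset_none hn i a d x y z 0).trans (by simp only [add_zero]))

end Succ

theorem succ_total (s : State m n) (a : Step k) :
    ((machineGame hn eL eE).succ s a).2 (totalClock hn) = s.2 (totalClock hn) + a.1 := by
  obtain ⟨l, ν⟩ := s
  obtain ⟨u, e⟩ := a
  obtain ⟨l, rfl⟩ := eL.surjective l
  obtain ⟨e, rfl⟩ := eE.surjective e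
  refine (congrFun (congrArg Prod.snd (succ_eq hn eL eE l ν u e)) _).trans (if_neg ?_)
  have h0 (i r : Fin 3) := (roleClock_ne_totalClock hn i r).symm
  have h1 := (phaseClock_ne_totalClock hn).symm
  cases e with
  | next t i => rcases hd : M.dst t <;> simp [Edge.resets, hd, h1]
  | _ => simp [Edge.resets, zeroClock, h0]

/-- The total clock is never reset, so its invariant bounds the elapsed time. -/
theorem stateAfter_total (s : State m n) (j : ℕ) (h : Fin j → Step k) :
    ((machineGame hn eL eE).stateAfter s j h).2 (totalClock hn) =
      s.2 (totalClock hn) + ∑ i, (h i).1 := by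
  induction j with
  | zero => simp [TimedAutomaton.stateAfter]
  | succ j ih =>
    rw [TimedAutomaton.stateAfter, succ_total, ih, Fin.sum_univ_castSucc, add_assoc]
    rfl

theorem sat_le_iff (ν : Fin n → ℝ) (c : Fin n) (q : ℕ) : Sat ν [(c, .le, q)] ↔ ν c ≤ q := by
  rw [sat_cons]
  exact ⟨fun h => h.1, fun h => ⟨h, sat_nil _⟩⟩

theorem sat_mid_iff (ν : Fin n → ℝ) (t : M.Tr) (i : Fin 3) :
    Sat ν ((Loc.mid t i).inv hn) ↔ ν (roleClock hn i 2) ≤ 0 ∧ ν (totalClock hn) ≤ 1 := by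
  rw [Loc.inv, sat_cons, sat_le_iff]
  simp [Cmp.Holds, zeroClock]

theorem sat_done_iff (ν : Fin n → ℝ) (t : M.Tr) (i : Fin 3) :
    Sat ν ((Loc.done t i).inv hn) ↔ ν (roleClock hn i 0) ≤ 0 ∧ ν (totalClock hn) ≤ 1 := by
  rw [Loc.inv, sat_cons, sat_le_iff]
  simp [Cmp.Holds, zeroClock]

/-! Legal moves -/

theorem trans_choose {t : M.Tr} {i : Fin 3} {a d x y z u : ℝ} (ha : 0 ≤ a) (hd : 0 ≤ d)
    (hx : 0 ≤ x) (hy : 0 ≤ y) (hz : 0 ≤ z) (hu : 0 ≤ u) (h : a + u ≤ 1) :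
    (machineGame hn eL eE).Trans (eL (.ctrl (M.src t) i), clocks hn i a d x y z)
      (u, eE (.choose t i)) := by
  refine (trans_edge_iff hn eL eE _ _ _ _).2 ⟨⟨clocks_nonneg hn ha hd hx hy hz, ?_⟩, rfl, hu, ?_,
    sat_nil _, ?_⟩
  · rw [Loc.inv, sat_le_iff, clocks_total]; push_cast; linarith
  · rw [clocks_delay, Loc.inv, sat_le_iff, clocks_total]; push_cast; linarith
  · have := congrArg Prod.snd ((succ_eq hn eL eE (.ctrl (M.src t) i) _ _ _).symm.trans
      (succ_choose (hn := hn) (eL := eL) (eE := eE) i a d x y z u (.ctrl (M.src t) i) t))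
    simp only at this
    rw [this, Edge.tgt, sat_mid_iff, clocks_total, clocks_role_two]
    exact ⟨le_rfl, h⟩

theorem trans_close {t : M.Tr} {i : Fin 3} {a d x y z u : ℝ} (ha : 0 ≤ a) (hd : 0 ≤ d)
    (hx : 0 ≤ x) (hy : 0 ≤ y) (hz : 0 ≤ z) (hu : 0 ≤ u) (h : a + u ≤ 1) :
    (machineGame hn eL eE).Trans (eL (.late t i), clocks hn i a d x y z)
      (u, eE (.close t i)) := by
  refine (trans_edge_iff hn eL eE _ _ _ _).2 ⟨⟨clocks_nonneg hn ha hd hx hy hz, ?_⟩, rfl, hu, ?_,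
    sat_nil _, ?_⟩
  · rw [Loc.inv, sat_le_iff, clocks_total]; push_cast; linarith
  · rw [clocks_delay, Loc.inv, sat_le_iff, clocks_total]; push_cast; linarith
  · have := congrArg Prod.snd ((succ_eq hn eL eE (.late t i) _ _ _).symm.trans
      (succ_close (hn := hn) (eL := eL) (eE := eE) i a d x y z u (.late t i) t))
    simp only at this
    rw [this, Edge.tgt, sat_done_iff, clocks_total, clocks_role_zero]
    exact ⟨le_rfl, h⟩

theorem trans_ctrl_cases {c : M.Ctrl} {i : Fin 3} {ν : Fin n → ℝ} {p : Step k}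
    (h : (machineGame hn eL eE).Trans (eL (.ctrl c i), ν) p) :
    0 ≤ p.1 ∧ ν (totalClock hn) + p.1 ≤ 1 ∧
      (p.2 = eE (.quit c i) ∨ ∃ t, M.src t = c ∧ p.2 = eE (.choose t i)) := by
  obtain ⟨u, e⟩ := p
  obtain ⟨e, rfl⟩ := eE.surjective e
  obtain ⟨-, h1, h2, h3, -⟩ := (trans_edge_iff hn eL eE _ _ _ _).1 h
  rw [Loc.inv, sat_le_iff, Nat.cast_one] at h3
  refine ⟨h2, h3, ?_⟩
  rcases e with _ | _ | ⟨_ | _, _, _⟩ | _ | _ | _ | _ | _ | _ | _ <;> cases h1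
  · exact .inr ⟨_, rfl, rfl⟩
  · exact .inl rfl

theorem trans_late_cases {t : M.Tr} {i : Fin 3} {ν : Fin n → ℝ} {p : Step k}
    (h : (machineGame hn eL eE).Trans (eL (.late t i), ν) p) :
    0 ≤ p.1 ∧ ν (totalClock hn) + p.1 ≤ 1 ∧
      (p.2 = eE (.quitLate t i) ∨ p.2 = eE (.close t i)) := by
  obtain ⟨u, e⟩ := p
  obtain ⟨e, rfl⟩ := eE.surjective e
  obtain ⟨-, h1, h2, h3, -⟩ := (trans_edge_iff hn eL eE _ _ _ _).1 h
  rw [Loc.inv, sat_le_iff, Nat.cast_one] at h3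
  refine ⟨h2, h3, ?_⟩
  rcases e with _ | _ | ⟨_ | _, _, _⟩ | _ | _ | _ | _ | _ | _ | _ <;> cases h1
  · exact .inr rfl
  · exact .inl rfl

/-- The invariant keeps a nonnegative clock at 0, so no time can pass and only the choice of the
edge is left to Player `□`. -/
theorem trans_mid_cases {t : M.Tr} {i : Fin 3} {ν : Fin n → ℝ} {p : Step k}
    (h : (machineGame hn eL eE).Trans (eL (.mid t i), ν) p) :
    p = (0, eE (.challenge false t i)) ∨ p = (0, eE (.pass t i)) := by
  obtain ⟨u, e⟩ := p
  obtain ⟨e, rfl⟩ := eE.surjective e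
  obtain ⟨h0, h1, h2, h3, -⟩ := (trans_edge_iff hn eL eE _ _ _ _).1 h
  rw [sat_mid_iff] at h3
  obtain rfl : u = 0 := le_antisymm (by linarith [h0.1 (roleClock hn i 2), h3.1]) h2
  rcases e with _ | _ | ⟨_ | _, _, _⟩ | _ | _ | _ | _ | _ | _ | _ <;> cases h1
  · exact .inl rfl
  · exact .inr rfl

theorem trans_done_cases {t : M.Tr} {i : Fin 3} {ν : Fin n → ℝ} {p : Step k}
    (h : (machineGame hn eL eE).Trans (eL (.done t i), ν) p) :
    p = (0, eE (.challenge true t i)) ∨ p = (0, eE (.next t i)) := by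
  obtain ⟨u, e⟩ := p
  obtain ⟨e, rfl⟩ := eE.surjective e
  obtain ⟨h0, h1, h2, h3, -⟩ := (trans_edge_iff hn eL eE _ _ _ _).1 h
  rw [sat_done_iff] at h3
  obtain rfl : u = 0 := le_antisymm (by linarith [h0.1 (roleClock hn i 0), h3.1]) h2
  rcases e with _ | _ | ⟨_ | _, _, _⟩ | _ | _ | _ | _ | _ | _ | _ <;> cases h1
  · exact .inl rfl
  · exact .inr rfl

/-! Strategies -/

section Strategies

variable {G : Game m n k} {s : State m n} {σ : G.Strategy .diamond} {τ : G.Strategy .box}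

theorem stateAfter_snoc (A : TimedAutomaton m n k) (j : ℕ) (h : Fin j → Step k) (a : Step k) :
    A.stateAfter s (j + 1) (Fin.snoc (α := fun _ => Step k) h a) =
      A.succ (A.stateAfter s j h) a := by
  rw [TimedAutomaton.stateAfter, Fin.init_snoc, Fin.snoc_last]

theorem Game.Follows.snoc_diamond {j : ℕ} {h : Fin j → Step k} (hf : Game.Follows s σ τ j h)
    (ho : G.owner (G.stateAfter s j h).1 = .diamond) :
    Game.Follows s σ τ (j + 1) (Fin.snoc (α := fun _ => Step k) h (σ.move s j h)) := by
  rw [Game.Follows, Fin.init_snoc, Fin.snoc_last]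
  exact ⟨hf, .inl ⟨ho, rfl⟩⟩

theorem Game.Follows.snoc_box {j : ℕ} {h : Fin j → Step k} (hf : Game.Follows s σ τ j h)
    (ho : G.owner (G.stateAfter s j h).1 = .box) :
    Game.Follows s σ τ (j + 1) (Fin.snoc (α := fun _ => Step k) h (τ.move s j h)) := by
  rw [Game.Follows, Fin.init_snoc, Fin.snoc_last]
  exact ⟨hf, .inr ⟨ho, rfl⟩⟩

end Strategies

theorem measurable_stateAfter_delays (A : TimedAutomaton m n k) (s : State m n) (j : ℕ)
    (e : Fin j → Fin k) :
    Measurable fun t : Fin j → ℝ => A.stateAfter s j fun i => (t i, e i) :=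
  (Game.measurable_stateAfter A s j).comp (measurable_pi_lambda _ fun i =>
    (measurable_pi_apply i).prodMk measurable_const)

open Classical in
/-- The strategy that makes in step `j` the move `(plan j).2` if it is in the state `(plan j).1`. -/
def planStrategy (hn : 5 ≤ n) (eL : Loc M ≃ Fin m) (eE : Edge M ≃ Fin k)
    (plan : ℕ → State m n × Step k) : (machineGame hn eL eE).Strategy .diamond where
  move s j h :=
    if (machineGame hn eL eE).stateAfter s j h = (plan j).1 ∧
        (machineGame hn eL eE).Trans (plan j).1 (plan j).2 then (plan j).2
    else (0, eE (defaultEdge (eL.symm ((machineGame hn eL eE).stateAfter s j h).1)))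
  legal s j h hr _ := by
    split_ifs with hp
    · rw [hp.1]; exact hp.2
    · have hs := hr.isState
      set q := (machineGame hn eL eE).stateAfter s j h with hq
      have := trans_defaultEdge hn eL eE (l := eL.symm q.1) (ν := q.2)
        (by rw [Equiv.apply_symm_apply]; exact hs)
      rw [Equiv.apply_symm_apply] at this
      exact this
  measurable_delays s j e := by
    have hm := measurable_stateAfter_delays (machineAutomaton hn eL eE) s j e
    refine Measurable.ite ?_ measurable_const ?_
    -- Legality of the planned move does not depend on the history; what remains is the event of
    -- being in one fixed state.
    · by_cases hc : (machineGame hn eL eE).Trans (plan j).1 (plan j).2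
      · simp only [hc, and_true]
        exact hm (measurableSet_singleton _)
      · simp [hc]
    · exact measurable_const.prodMk ((measurable_of_finite
        (fun l => eE (defaultEdge (eL.symm l)))).comp hm.fst)

theorem planStrategy_move {plan : ℕ → State m n × Step k} {s : State m n} {j : ℕ}
    {h : Fin j → Step k} (h1 : (machineGame hn eL eE).stateAfter s j h = (plan j).1)
    (h2 : (machineGame hn eL eE).Trans (plan j).1 (plan j).2) :
    (planStrategy hn eL eE plan).move s j h = (plan j).2 :=
  if_pos ⟨h1, h2⟩

/-- The edge chosen by Player `□` when he challenges or does not challenge his opponent. -/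
def boxEdge : Bool → Loc M → Edge M
  | false, .mid t i => .pass t i
  | false, .done t i => .next t i
  | _, l => defaultEdge l

theorem trans_boxEdge {l : Loc M} {ν : Fin n → ℝ} (b : Bool)
    (h : (machineAutomaton hn eL eE).IsState (eL l, ν)) :
    (machineAutomaton hn eL eE).Trans (eL l, ν) (0, eE (boxEdge b l)) := by
  cases b with
  | true => exact trans_defaultEdge hn eL eE h
  | false =>
    cases l with
    | mid t i =>
      have h' := (isState_iff hn eL eE _ _).1 h
      refine (trans_edge_iff hn eL eE _ _ _ _).2 ⟨h', rfl, le_rfl, by simpa using h'.2,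
        sat_nil _, ?_⟩
      have h2 := (sat_mid_iff _ _ _).1 h'.2
      simp only [boxEdge, Edge.resets, Edge.tgt, Loc.inv, sat_le_iff]
      simpa using h2.2
    | done t i =>
      have h' := (isState_iff hn eL eE _ _).1 h
      refine (trans_edge_iff hn eL eE _ _ _ _).2 ⟨h', rfl, le_rfl, by simpa using h'.2,
        sat_nil _, ?_⟩
      have h2 := (sat_done_iff _ _ _).1 h'.2
      rcases hd : M.dst t with _ | c
      · simp only [boxEdge, Edge.resets, Edge.tgt, Loc.inv, hd, sat_cons, sat_nil, Cmp.Holds,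
          zeroClock]
        simpa using h2.1.trans_lt one_pos
      · simp only [boxEdge, Edge.resets, Edge.tgt, Loc.inv, hd, sat_le_iff]
        simpa [(phaseClock_ne_totalClock hn).symm] using h2.2
    | _ => exact trans_defaultEdge hn eL eE h

/-- The strategy of Player `□` that challenges in the steps `j` with `f j = true`. -/
def boxStrategy (hn : 5 ≤ n) (eL : Loc M ≃ Fin m) (eE : Edge M ≃ Fin k) (f : ℕ → Bool) :
    (machineGame hn eL eE).Strategy .box where
  move s j h := (0, eE (boxEdge (f j) (eL.symm ((machineGame hn eL eE).stateAfter s j h).1)))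
  legal s j h hr _ := by
    have hs := hr.isState
    set q := (machineGame hn eL eE).stateAfter s j h with hq
    have := trans_boxEdge (hn := hn) (eL := eL) (eE := eE) (l := eL.symm q.1) (ν := q.2) (f j)
      (by rw [Equiv.apply_symm_apply]; exact hs)
    rw [Equiv.apply_symm_apply] at this
    exact this
  measurable_delays s j e :=
    measurable_const.prodMk ((measurable_of_finite
      (fun l => eE (boxEdge (f j) (eL.symm l)))).comp
      (measurable_stateAfter_delays (machineAutomaton hn eL eE) s j e).fst)

theorem boxStrategy_move {f : ℕ → Bool} {s : State m n} {j : ℕ} {h : Fin j → Step k} {l : Loc M}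
    (hl : ((machineGame hn eL eE).stateAfter s j h).1 = eL l) :
    (boxStrategy hn eL eE f).move s j h = (0, eE (boxEdge (f j) l)) := by
  simp [boxStrategy, hl]

/-- Histories do not reveal later challenges. An unchallenged history therefore also occurs under
the strategy that first challenges at its end. -/
theorem Game.Follows.congr_boxStrategy {f g : ℕ → Bool} {s : State m n}
    {σ : (machineGame hn eL eE).Strategy .diamond} {j : ℕ} {h : Fin j → Step k}
    (hfg : ∀ i < j, f i = g i) (hf : Game.Follows s σ (boxStrategy hn eL eE f) j h) :
    Game.Follows s σ (boxStrategy hn eL eE g) j h := by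
  induction j with
  | zero => trivial
  | succ j ih =>
    refine ⟨ih (fun i hi => hfg i (by omega)) hf.1, ?_⟩
    have : (boxStrategy hn eL eE f).move s j (Fin.init h) =
        (boxStrategy hn eL eE g).move s j (Fin.init h) := by
      simp [boxStrategy, hfg j (by omega)]
    rw [← this]
    exact hf.2

end Dynamics

/-! ### Correctness of the simulation -/

section Correctness

variable {M : AffineMachine} {n m k : ℕ} {hn : 5 ≤ n} {eL : Loc M ≃ Fin m} {eE : Edge M ≃ Fin k}

/-- The state at the beginning of a phase in which the numbers `v` and `w` are stored and `r` time
units remain. -/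
def phaseState (hn : 5 ≤ n) (eL : Loc M ≃ Fin m) (c : M.Ctrl) (i : Fin 3) (r v w : ℝ) : State m n :=
  -- The two forms fit together: while `r / 2` time units pass, `r * w` grows to `(r / 2) * (2 * w +
  -- 1)`, the form of the number to be updated in the next phase.
  (eL (.ctrl c i), clocks hn i (1 - r) 0 (r * (2 * v + 1)) (r * w) 0)

variable {s : State m n} {σ : (machineGame hn eL eE).Strategy .diamond}
  {τ : (machineGame hn eL eE).Strategy .box}

/-- The probability to reach the goal within five time units. -/
def goalProbability (s : State m n) (σ : (machineGame hn eL eE).Strategy .diamond)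
    (τ : (machineGame hn eL eE).Strategy .box) : ℝ :=
  (Game.runMeasure s σ τ).real {ω | (machineGame hn eL eE).VisitsWithin s {eL .goal} 5 ω}

theorem goalProbability_of_check (hs : (machineGame hn eL eE).IsState s) {j : ℕ}
    {h : Fin j → Step k} (hf : Game.Follows s σ τ j h) {b : Bool} {t : M.Tr} {i : Fin 3}
    {a d x y z : ℝ} (hst : (machineGame hn eL eE).stateAfter s j h =
      (eL (.check b t i), clocks hn i a d x y z))
    (ha : a ≤ 1) (hd : d ≤ 1) (hx : x ≤ 1) (hz : z ≤ 1) (h0 : (if b then x else z) = 0) :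
    goalProbability s σ τ =
      checkValue t b fun c => clocks hn i a d x y z (testClock hn b i c) := by
  refine visit_probability_of_check hs hf hst ?_ (clocks_testClock_le ha hd hx hz) ?_
  · cases b
    · rw [zeroClock, clocks_role_two]; simpa using h0
    · rw [zeroClock, clocks_role_zero]; simpa using h0
  · have h1 := stateAfter_total (hn := hn) (eL := eL) (eE := eE) s j h
    simp only [hst, clocks_total] at h1
    -- The total clock starts at a nonnegative value and is at most 1, so at most one time unit has
    -- passed.
    linarith [hs.1 (totalClock hn)]

theorem goalProbability_of_challenge_mid (hs : (machineGame hn eL eE).IsState s) {j : ℕ}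
    {h : Fin j → Step k} (hf : Game.Follows s σ τ j h) {t : M.Tr} {i : Fin 3} {a d x y : ℝ}
    (hst : (machineGame hn eL eE).stateAfter s j h = (eL (.mid t i), clocks hn i a d x y 0))
    (ha : a ≤ 1) (hd : d ≤ 1) (hx : x ≤ 1)
    (hτ : τ.move s j h = (0, eE (.challenge false t i))) :
    goalProbability s σ τ = 1 / 2 ↔
      M.coef t * x + (2 * M.scale t + 2 * (M.gain t - M.drop t) - 2 * M.coef t) * d +
        (M.coef t + 2 * M.scale t - 2 * (M.gain t - M.drop t)) * a =
      M.coef t + 2 * M.scale t - 2 * (M.gain t - M.drop t) := by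
  have hf' := hf.snoc_box (by rw [hst, machineGame_owner]; rfl)
  rw [← checkValue_false_iff (hn := hn) t i a d x y]
  rw [goalProbability_of_check hs hf' (b := false) (t := t) (i := i) (a := a) (d := d) (x := x)
    (y := y) (z := 0) _ ha hd hx zero_le_one rfl]
  rw [stateAfter_snoc, hst, hτ, succ_challenge]

theorem goalProbability_of_challenge_done (hs : (machineGame hn eL eE).IsState s) {j : ℕ}
    {h : Fin j → Step k} (hf : Game.Follows s σ τ j h) {t : M.Tr} {i : Fin 3} {a d y z : ℝ}
    (hst : (machineGame hn eL eE).stateAfter s j h = (eL (.done t i), clocks hn i a d 0 y z))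
    (ha : a ≤ 1) (hd : d ≤ 1) (hz : z ≤ 1)
    (hτ : τ.move s j h = (0, eE (.challenge true t i)) ∨
      τ.move s j h = (0, eE (.next t i)) ∧ M.dst t = none) :
    goalProbability s σ τ = 1 / 2 ↔ d + a = 1 := by
  have hf' := hf.snoc_box (by rw [hst, machineGame_owner]; rfl)
  rw [← checkValue_true_iff (hn := hn) t i a d y z]
  rw [goalProbability_of_check hs hf' (b := true) (t := t) (i := i) (a := a) (d := d) (x := 0)
    (y := y) (z := z) _ ha hd zero_le_one hz rfl]
  rcases hτ with hτ | ⟨hτ, hd⟩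
  · rw [stateAfter_snoc, hst, hτ, succ_challenge]
  · rw [stateAfter_snoc, hst, hτ, succ_next_none _ _ _ _ _ _ _ hd]

/-! Accepting machines -/

/-- If Player `◇` simulates a transition correctly, the goal is reached with probability `1 / 2`, or
the next phase begins. -/
theorem phase_of_correct_moves (hs : (machineGame hn eL eE).IsState s) {j : ℕ} {h : Fin j → Step k}
    (hf : Game.Follows s σ τ j h) {t : M.Tr} {i : Fin 3} {r v w v' : ℝ} (hr : 0 < r ∧ r ≤ 1 / 8)
    (hv : 0 ≤ v ∧ v ≤ 1) (ht : M.Moves t v v')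
    (hst : (machineGame hn eL eE).stateAfter s j h = phaseState hn eL (M.src t) i r v w)
    (h1 : ∀ h, (machineGame hn eL eE).stateAfter s j h = phaseState hn eL (M.src t) i r v w →
      σ.move s j h = (r / 2 * (1 - v'), eE (.choose t i)))
    (h3 : ∀ h, (machineGame hn eL eE).stateAfter s (j + 2) h =
      (eL (.late t i), clocks hn i (1 - r + r / 2 * (1 - v')) (r / 2 * (1 - v'))
        (r * (2 * v + 1) + r / 2 * (1 - v')) (r * w + r / 2 * (1 - v')) 0) →
      σ.move s (j + 2) h = (r / 2 * v', eE (.close t i))) :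
    goalProbability s σ τ = 1 / 2 ∨ ∃ c h', M.dst t = some c ∧ Game.Follows s σ τ (j + 4) h' ∧
      (machineGame hn eL eE).stateAfter s (j + 4) h' =
        phaseState hn eL c (i + 1) (r / 2) w v' := by
  obtain ⟨⟨hv0, hv1⟩, he⟩ := ht
  have hp : 0 ≤ r * v' := mul_nonneg hr.1.le hv0
  have hp1 : r * v' ≤ r := by nlinarith
  have hp2 : r * v ≤ r := by nlinarith
  have hf1 := hf.snoc_diamond (by rw [hst, phaseState, machineGame_owner]; rfl)
  rw [h1 _ hst] at hf1
  generalize hg1 : Fin.snoc (α := fun _ => Step k) h _ = g1 at hf1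
  have hs1 := stateAfter_snoc (s := s) (machineGame hn eL eE).toTimedAutomaton j h (r / 2 * (1 - v'), eE (.choose t i))
  rw [hst, phaseState, succ_choose, hg1, zero_add] at hs1
  have hτ1 := τ.legal s _ g1 (hf1.isRun hs) (by rw [hs1, machineGame_owner]; rfl)
  have hf2 := hf1.snoc_box (by rw [hs1, machineGame_owner]; rfl)
  rw [hs1] at hτ1
  rcases trans_mid_cases hτ1 with hm1 | hm1
  · left
    refine (goalProbability_of_challenge_mid hs hf1 hs1 (by linarith) (by linarith) (by linarith)
      hm1).2 ?_
    -- With the first delay `r / 2 * (1 - v')`, the tested relation is the update rule multiplied by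
    -- `2 * r`.
    linear_combination (-2 * r) * he
  rw [hm1] at hf2
  generalize hg2 : Fin.snoc (α := fun _ => Step k) g1 _ = g2 at hf2
  have hs2 := stateAfter_snoc (s := s) (machineGame hn eL eE).toTimedAutomaton (j + 1) g1 (0, eE (.pass t i))
  rw [hs1, succ_pass, hg2] at hs2
  replace hs2 : (machineGame hn eL eE).stateAfter s (j + 2) g2 = _ := hs2
  have hf3 := Game.Follows.snoc_diamond (j := j + 2) hf2 (by rw [hs2, machineGame_owner]; rfl)
  rw [h3 _ hs2] at hf3
  generalize hg3 : Fin.snoc (α := fun _ => Step k) g2 _ = g3 at hf3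
  have hs3 := stateAfter_snoc (s := s) (machineGame hn eL eE).toTimedAutomaton (j + 2) g2 (r / 2 * v', eE (.close t i))
  rw [hs2, succ_close, hg3] at hs3
  replace hs3 : (machineGame hn eL eE).stateAfter s (j + 3) g3 = _ := hs3
  have hτ3 := τ.legal s _ g3 (hf3.isRun hs) (by rw [hs3, machineGame_owner]; rfl)
  have hf4 := Game.Follows.snoc_box (j := j + 3) hf3 (by rw [hs3, machineGame_owner]; rfl)
  rw [hs3] at hτ3
  rcases trans_done_cases hτ3 with hm3 | hm3
  · left
    refine (goalProbability_of_challenge_done hs hf3 hs3 (by linarith) (by linarith) (by linarith)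
      (.inl hm3)).2 ?_
    ring
  rcases hdst : M.dst t with _ | c
  · left
    refine (goalProbability_of_challenge_done hs hf3 hs3 (by linarith) (by linarith) (by linarith)
      (.inr ⟨hm3, hdst⟩)).2 ?_
    ring
  right
  refine ⟨c, _, rfl, hf4, ?_⟩
  rw [stateAfter_snoc, hs3, hm3, succ_next_some _ _ _ _ _ _ hdst, phaseState]
  congr 2 <;> ring

/-- Induction on acceptance. Until a challenge the play does not depend on Player `□`, so a plan
indexed by the step number suffices. The claim is made for all `plan'` that agree with `plan` from
step `j` on; hence the plan for the later phases keeps its effect when the entries of the current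
phase are put in front. -/
theorem exists_plan_of_accepts {c : M.Ctrl} {v w : ℝ} (hc : M.Accepts c v w) :
    (0 ≤ v ∧ v ≤ 1) → (0 ≤ w ∧ w ≤ 1) → ∀ (i : Fin 3) (r : ℝ), 0 < r ∧ r ≤ 1 / 8 → ∀ j : ℕ,
    ∃ plan : ℕ → State m n × Step k, ∀ plan', (∀ l ≥ j, plan' l = plan l) →
      ∀ (s : State m n) (τ : (machineGame hn eL eE).Strategy .box) (h : Fin j → Step k),
      (machineGame hn eL eE).IsState s →
      Game.Follows s (planStrategy hn eL eE plan') τ j h →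
      (machineGame hn eL eE).stateAfter s j h = phaseState hn eL c i r v w →
      goalProbability s (planStrategy hn eL eE plan') τ = 1 / 2 := by
  have key : ∀ {t : M.Tr} {v w v' : ℝ}, M.Moves t v v' → (0 ≤ v ∧ v ≤ 1) → (0 ≤ w ∧ w ≤ 1) →
      ∀ (i : Fin 3) (r : ℝ), 0 < r ∧ r ≤ 1 / 8 → ∀ (j : ℕ) (rest : ℕ → State m n × Step k),
      ∃ plan : ℕ → State m n × Step k, (∀ l ≥ j + 4, plan l = rest l) ∧
        ∀ plan', (∀ l ≥ j, plan' l = plan l) →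
        ∀ (s : State m n) (τ : (machineGame hn eL eE).Strategy .box) (h : Fin j → Step k),
        (machineGame hn eL eE).IsState s →
        Game.Follows s (planStrategy hn eL eE plan') τ j h →
        (machineGame hn eL eE).stateAfter s j h = phaseState hn eL (M.src t) i r v w →
        goalProbability s (planStrategy hn eL eE plan') τ = 1 / 2 ∨
          ∃ c h', M.dst t = some c ∧ Game.Follows s (planStrategy hn eL eE plan') τ (j + 4) h' ∧
            (machineGame hn eL eE).stateAfter s (j + 4) h' =
              phaseState hn eL c (i + 1) (r / 2) w v' := by
    intro t v w v' ht hv hw i r hr j rest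
    have hp : 0 ≤ r * v' := mul_nonneg hr.1.le ht.1.1
    have hp1 : r * v' ≤ r := by nlinarith [ht.1.2]
    have hp2 : 0 ≤ r * v := mul_nonneg hr.1.le hv.1
    have hp3 : 0 ≤ r * w := mul_nonneg hr.1.le hw.1
    let p1 : State m n × Step k :=
      (phaseState hn eL (M.src t) i r v w, (r / 2 * (1 - v'), eE (.choose t i)))
    let p3 : State m n × Step k :=
      ((eL (.late t i), clocks hn i (1 - r + r / 2 * (1 - v')) (r / 2 * (1 - v'))
        (r * (2 * v + 1) + r / 2 * (1 - v')) (r * w + r / 2 * (1 - v')) 0),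
        (r / 2 * v', eE (.close t i)))
    -- Player `◇` moves in the first and third of the four steps of a phase; the delays add up to `r
    -- / 2`.
    refine ⟨fun l => if l = j then p1 else if l = j + 2 then p3 else rest l, fun l hl => ?_,
      fun plan' hplan s τ h hs hf hst => ?_⟩
    · exact (if_neg (by omega)).trans (if_neg (by omega))
    have e1 : plan' j = p1 := (hplan j le_rfl).trans (if_pos rfl)
    have e3 : plan' (j + 2) = p3 :=
      (hplan (j + 2) (by omega)).trans ((if_neg (by omega)).trans (if_pos rfl))
    refine phase_of_correct_moves hs hf hr hv ht hst (fun h hst => ?_) (fun h hst => ?_)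
    · refine (planStrategy_move (by rw [e1]; exact hst) ?_).trans (by rw [e1])
      rw [e1]
      exact trans_choose (by linarith) le_rfl (by linarith) hp3 le_rfl (by linarith) (by linarith)
    · refine (planStrategy_move (by rw [e3]; exact hst) ?_).trans (by rw [e3])
      rw [e3]
      exact trans_close (by linarith) (by linarith) (by linarith) (by linarith) le_rfl
        (by linarith) (by linarith)
  induction hc with
  | halt ht hd =>
    intro hv hw i r hr j
    obtain ⟨plan, -, hplan⟩ := key ht hv hw i r hr j
      fun _ => ((eL .goal, fun _ => 0), (0, eE .stayGoal))
    refine ⟨plan, fun plan' hpl s τ h hs hf hst => ?_⟩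
    rcases hplan plan' hpl s τ h hs hf hst with h1 | ⟨c, _, hc, _⟩
    · exact h1
    · rw [hd] at hc; cases hc
  | step ht hd _ ih =>
    intro hv hw i r hr j
    obtain ⟨rest, hrest⟩ := ih hw ht.1 (i + 1) (r / 2)
      ⟨by linarith [hr.1], by linarith [hr.1, hr.2]⟩ (j + 4)
    obtain ⟨plan, hpr, hplan⟩ := key ht hv hw i r hr j rest
    refine ⟨plan, fun plan' hpl s τ h hs hf hst => ?_⟩
    rcases hplan plan' hpl s τ h hs hf hst with h1 | ⟨c, h', hc, hf', hst'⟩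
    · exact h1
    · rw [hd] at hc
      cases hc
      exact hrest plan' (fun l hl => (hpl l (by omega)).trans (hpr l hl)) s τ h' hs hf' hst'

theorem diamondWins_of_accepts {c : M.Ctrl} {v w : ℝ} (hc : M.Accepts c v w)
    (hv : 0 ≤ v ∧ v ≤ 1) (hw : 0 ≤ w ∧ w ≤ 1) {i : Fin 3}
    (hs : (machineGame hn eL eE).IsState (phaseState hn eL c i (1 / 8) v w)) :
    (machineGame hn eL eE).DiamondWins (phaseState hn eL c i (1 / 8) v w) {eL .goal} 5 .eq
      (1 / 2) := by
  obtain ⟨plan, hplan⟩ := exists_plan_of_accepts (hn := hn) (eL := eL) (eE := eE) hc hv hw i (1 / 8)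
    ⟨by norm_num, le_rfl⟩ 0
  exact ⟨planStrategy hn eL eE plan, fun τ =>
    hplan plan (fun _ _ => rfl) _ τ Fin.elim0 hs trivial rfl⟩

/-! Machines that do not accept -/

/-- The goal is absorbing, so almost sure histories that are outside it at arbitrarily late steps
exclude every visit. -/
theorem goalProbability_eq_zero (hs : (machineGame hn eL eE).IsState s)
    (H : ∀ j, ∃ j' ≥ j, ∃ h, Game.Follows s σ τ j' h ∧
      ((machineGame hn eL eE).stateAfter s j' h).1 ≠ eL .goal) : goalProbability s σ τ = 0 := by
  choose J hJ h hf hg using H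
  have h1 : ∀ᵐ ω ∂Game.runMeasure s σ τ, ∀ j, Game.firstSteps (J j) ω = h j :=
    ae_all_iff.2 fun j => (hf j).ae_firstSteps
  have h2 : ∀ᵐ ω ∂Game.runMeasure s σ τ, ¬ (machineGame hn eL eE).VisitsWithin s {eL .goal} 5 ω := by
    filter_upwards [h1, Game.ae_isRun hs] with ω e1 e2
    rintro ⟨j, hj, -⟩
    refine hg j ?_
    rw [← e1 j]
    exact locAfter_goal e2 (hJ j) hj
  have h3 : Game.runMeasure s σ τ {ω | (machineGame hn eL eE).VisitsWithin s {eL .goal} 5 ω} = 0 :=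
    measure_eq_zero_iff_ae_notMem.2 h2
  rw [goalProbability, Measure.real, h3, ENNReal.toReal_zero]

theorem goalProbability_of_sink (hs : (machineGame hn eL eE).IsState s) {j : ℕ} {h : Fin j → Step k}
    (hf : Game.Follows s σ τ j h)
    (hst : ((machineGame hn eL eE).stateAfter s j h).1 = eL .sink) : goalProbability s σ τ = 0 := by
  refine goalProbability_eq_zero hs fun l => ⟨j + l, by omega, ?_⟩
  have : ∃ h', Game.Follows s σ τ (j + l) h' ∧
      ((machineGame hn eL eE).stateAfter s (j + l) h').1 = eL .sink := by
    induction l with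
    | zero => exact ⟨h, hf, hst⟩
    | succ l ih =>
      obtain ⟨h', hf', hst'⟩ := ih
      have ho : (machineGame hn eL eE).owner ((machineGame hn eL eE).stateAfter s (j + l) h').1
        = .box := by rw [hst', machineGame_owner]; rfl
      refine ⟨_, hf'.snoc_box ho, ?_⟩
      have := sink_of_trans hst' (τ.legal s _ h' (hf'.isRun hs) ho)
      rw [← stateAfter_snoc] at this
      exact this
  obtain ⟨h', hf', hst'⟩ := this
  exact ⟨h', hf', by rw [hst']; simp⟩

/-- The strategy of Player `□` that never challenges. -/
abbrev neverChallenge (hn : 5 ≤ n) (eL : Loc M ≃ Fin m) (eE : Edge M ≃ Fin k) :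
    (machineGame hn eL eE).Strategy .box :=
  boxStrategy hn eL eE fun _ => false

/-- Each test that Player `□` omits could have taken place after the same history, so the value
`1/2` forces both linear relations and the delays encode a transition of the machine. Quitting would
give probability 0. The transition cannot accept, and its result cannot lead to acceptance, since
`c` with `v` and `w` does not. -/
theorem next_phase_of_forall_eq_half (hs : (machineGame hn eL eE).IsState s)
    (hσ : ∀ τ, goalProbability s σ τ = 1 / 2) {j : ℕ} {h : Fin j → Step k}
    (hf : Game.Follows s σ (neverChallenge hn eL eE) j h) {c : M.Ctrl} {i : Fin 3} {r v w : ℝ}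
    (hr : 0 < r ∧ r ≤ 1 / 8) (hv : 0 ≤ v ∧ v ≤ 1) (hw : 0 ≤ w ∧ w ≤ 1) (hc : ¬ M.Accepts c v w)
    (hst : (machineGame hn eL eE).stateAfter s j h = phaseState hn eL c i r v w) :
    ∃ c' v' h', ¬ M.Accepts c' w v' ∧ (0 ≤ v' ∧ v' ≤ 1) ∧
      Game.Follows s σ (neverChallenge hn eL eE) (j + 4) h' ∧
      (machineGame hn eL eE).stateAfter s (j + 4) h' =
        phaseState hn eL c' (i + 1) (r / 2) w v' := by
  have no_sink : ∀ {j : ℕ} {h : Fin j → Step k} {τ}, Game.Follows s σ τ j h →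
      ((machineGame hn eL eE).stateAfter s j h).1 ≠ eL .sink := fun {j h τ} hf he => by
    have := goalProbability_of_sink hs hf he
    rw [hσ] at this
    norm_num at this
  have hp1 : r * v ≤ r := by nlinarith
  have hp2 : r * w ≤ r := by nlinarith
  have ho : (machineGame hn eL eE).owner ((machineGame hn eL eE).stateAfter s j h).1 = .diamond := by
    rw [hst, phaseState, machineGame_owner]; rfl
  have hσ1 := σ.legal s _ h (hf.isRun hs) ho
  have hf1 := hf.snoc_diamond ho
  generalize hmv : σ.move s j h = mv at hσ1 hf1
  obtain ⟨δ, e⟩ := mv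
  rw [hst, phaseState] at hσ1
  obtain ⟨hδ, hδr, hq⟩ := trans_ctrl_cases hσ1
  rw [clocks_total] at hδr
  simp only at hδ hδr hq
  generalize hg1 : Fin.snoc (α := fun _ => Step k) h _ = g1 at hf1
  rcases hq with rfl | ⟨t, rfl, rfl⟩
  · refine absurd ?_ (no_sink hf1)
    rw [← hg1, stateAfter_snoc, hst, phaseState]
    exact congrArg Prod.fst (succ_eq hn eL eE _ _ _ _)
  have hs1 := stateAfter_snoc (s := s) (machineGame hn eL eE).toTimedAutomaton j h (δ, eE (.choose t i))
  rw [hst, phaseState, succ_choose, hg1, zero_add] at hs1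
  -- The comparison strategy challenges in step `j + 1` only and agrees with `neverChallenge`
  -- before.
  have heq1 := (goalProbability_of_challenge_mid hs
    (hf1.congr_boxStrategy (g := fun l => l == j + 1) fun l hl => by
      rw [eq_comm, beq_eq_false_iff_ne]; omega) hs1 (by linarith) (by linarith) (by linarith)
    (by rw [boxStrategy_move (congrArg Prod.fst hs1)]; simp [boxEdge, defaultEdge])).1 (hσ _)
  have hf2 := hf1.snoc_box (by rw [hs1, machineGame_owner]; rfl)
  rw [boxStrategy_move (congrArg Prod.fst hs1), boxEdge] at hf2
  generalize hg2 : Fin.snoc (α := fun _ => Step k) g1 _ = g2 at hf2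
  have hs2 := stateAfter_snoc (s := s) (machineGame hn eL eE).toTimedAutomaton (j + 1) g1 (0, eE (.pass t i))
  rw [hs1, succ_pass, hg2] at hs2
  replace hs2 : (machineGame hn eL eE).stateAfter s (j + 2) g2 = _ := hs2
  have ho2 : (machineGame hn eL eE).owner ((machineGame hn eL eE).stateAfter s (j + 2) g2).1 =
      .diamond := by rw [hs2, machineGame_owner]; rfl
  have hσ3 := σ.legal s (j + 2) g2 (hf2.isRun hs) ho2
  have hf3 := Game.Follows.snoc_diamond (j := j + 2) hf2 ho2
  generalize hmv' : σ.move s (j + 2) g2 = mv at hσ3 hf3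
  obtain ⟨ε, e⟩ := mv
  rw [hs2] at hσ3
  obtain ⟨hε, hεr, hq⟩ := trans_late_cases hσ3
  rw [clocks_total] at hεr
  simp only at hε hεr hq
  generalize hg3 : Fin.snoc (α := fun _ => Step k) g2 _ = g3 at hf3
  rcases hq with rfl | rfl
  · refine absurd ?_ (no_sink (j := j + 3) hf3)
    rw [← hg3, stateAfter_snoc, hs2]
    exact congrArg Prod.fst (succ_eq hn eL eE _ _ _ _)
  have hs3 := stateAfter_snoc (s := s) (machineGame hn eL eE).toTimedAutomaton (j + 2) g2 (ε, eE (.close t i))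
  rw [hs2, succ_close, hg3] at hs3
  replace hs3 : (machineGame hn eL eE).stateAfter s (j + 3) g3 = _ := hs3
  have heq3 := (goalProbability_of_challenge_done hs
    (Game.Follows.congr_boxStrategy (j := j + 3) (g := fun l => l == j + 3) (fun l hl => by
      rw [eq_comm, beq_eq_false_iff_ne]; omega) hf3) hs3 (by linarith) (by linarith) (by linarith)
    (by rw [boxStrategy_move (congrArg Prod.fst hs3)]; simp [boxEdge, defaultEdge])).1 (hσ _)
  -- The new number is read off from the second delay. It is nonnegative because `ε` is, and at most
  -- 1 because `δ = r / 2 - ε` is nonnegative.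
  have hmoves : M.Moves t v (2 * ε / r) := by
    have hεδ : ε = r / 2 - δ := by linarith
    have hr0 := hr.1.ne'
    refine ⟨⟨div_nonneg (by linarith) hr.1.le, (div_le_one hr.1).2 (by linarith)⟩, ?_⟩
    have hx : r * (2 * ε / r) = r - 2 * δ := by rw [mul_div_cancel₀ _ hr0, hεδ]; ring
    have : (2 * r) * (M.scale t * (2 * ε / r) + M.drop t) =
        (2 * r) * (M.coef t * v + M.gain t) := by
      linear_combination 2 * M.scale t * hx - heq1
    exact mul_left_cancel₀ (by simpa using hr0) this
  rcases hdst : M.dst t with _ | c'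
  · exact absurd (.halt hmoves hdst) hc
  have hf4 := Game.Follows.snoc_box (j := j + 3) hf3 (by rw [hs3, machineGame_owner]; rfl)
  rw [boxStrategy_move (j := j + 3) (congrArg Prod.fst hs3), boxEdge] at hf4
  refine ⟨c', 2 * ε / r, _, fun ha => hc (.step hmoves hdst ha), hmoves.1, hf4, ?_⟩
  rw [stateAfter_snoc, hs3, succ_next_some _ _ _ _ _ _ hdst, phaseState]
  have hr0 := hr.1.ne'
  congr 2
  · linarith
  · linarith
  · field_simp; ring

/-- Otherwise the unchallenged play passes through infinitely many phases of four steps each without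
reaching the goal, and has probability 0 instead of `1/2`. -/
theorem accepts_of_diamondWins {c : M.Ctrl} {v w : ℝ} (hv : 0 ≤ v ∧ v ≤ 1) (hw : 0 ≤ w ∧ w ≤ 1)
    {i : Fin 3} (hs : (machineGame hn eL eE).IsState (phaseState hn eL c i (1 / 8) v w))
    (hwin : (machineGame hn eL eE).DiamondWins (phaseState hn eL c i (1 / 8) v w) {eL .goal} 5 .eq
      (1 / 2)) : M.Accepts c v w := by
  by_contra hc
  obtain ⟨σ, hσ⟩ := hwin
  set s := phaseState hn eL c i (1 / 8) v w with hs_def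
  replace hσ : ∀ τ, goalProbability s σ τ = 1 / 2 := hσ
  have H : ∀ l : ℕ, ∃ (h : Fin (4 * l) → Step k) (c : M.Ctrl) (i : Fin 3) (r v w : ℝ),
      Game.Follows s σ (neverChallenge hn eL eE) (4 * l) h ∧ (0 < r ∧ r ≤ 1 / 8) ∧
      (0 ≤ v ∧ v ≤ 1) ∧ (0 ≤ w ∧ w ≤ 1) ∧ ¬ M.Accepts c v w ∧
      (machineGame hn eL eE).stateAfter s (4 * l) h = phaseState hn eL c i r v w := by
    intro l
    induction l with
    | zero => exact ⟨Fin.elim0, c, i, 1 / 8, v, w, trivial, by norm_num, hv, hw, hc, rfl⟩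
    | succ l ih =>
      obtain ⟨h, c, i, r, v, w, hf, hr, hv, hw, hc, hst⟩ := ih
      obtain ⟨c', v', h', hc', hv', hf', hst'⟩ :=
        next_phase_of_forall_eq_half hs hσ hf hr hv hw hc hst
      exact ⟨h', c', i + 1, r / 2, w, v', hf', ⟨by linarith, by linarith⟩, hw, hv', hc', hst'⟩
  have h0 : goalProbability s σ (neverChallenge hn eL eE) = 0 := by
    refine goalProbability_eq_zero hs fun j => ?_
    obtain ⟨h, c, i, r, v, w, hf, -, -, -, -, hst⟩ := H j
    exact ⟨4 * j, by omega, h, hf, by rw [hst]; simp [phaseState]⟩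
  rw [hσ] at h0
  norm_num at h0

theorem diamondWins_iff_accepts {c : M.Ctrl} {v w : ℝ} (hv : 0 ≤ v ∧ v ≤ 1) (hw : 0 ≤ w ∧ w ≤ 1)
    {i : Fin 3} (hs : (machineGame hn eL eE).IsState (phaseState hn eL c i (1 / 8) v w)) :
    (machineGame hn eL eE).DiamondWins (phaseState hn eL c i (1 / 8) v w) {eL .goal} 5 .eq
      (1 / 2) ↔ M.Accepts c v w :=
  ⟨accepts_of_diamondWins hv hw hs, fun hc => diamondWins_of_accepts hc hv hw hs⟩

end Correctness

/-! The input that describes the game of an affine machine -/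

section Reduction

variable {M : AffineMachine} {n m k : ℕ} (hn : 5 ≤ n) (eL : Loc M ≃ Fin m) (eE : Edge M ≃ Fin k)

/-- The clock values of the start state in which the fraction `p.1 / p.2` and `0` are stored. -/
def startClocks (p : ℕ × ℕ) : Fin n → ℕ × ℕ := fun x =>
  -- `ratVal` adds 1 to the second component: the denominator here is `8 * p.2`, and `(7, 7)` stands
  -- for `7/8`, which leaves `r = 1/8`.
  if x = roleClock hn 0 0 then (2 * p.1 + p.2, 8 * p.2 - 1)
  else if x = roleClock hn 0 1 then (0, 0)
  else if x = roleClock hn 0 2 then (0, 0)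
  else if x = phaseClock hn then (0, 0)
  else (7, 7)

theorem ratVal_startClocks {p : ℕ × ℕ} (hp : 0 < p.2) (x : Fin n) :
    ratVal (startClocks hn p x) =
      clocks hn 0 (1 - 1 / 8) 0 (1 / 8 * (2 * ((p.1 : ℝ) / p.2) + 1)) (1 / 8 * 0) 0 x := by
  have hp' : (p.2 : ℝ) ≠ 0 := by exact_mod_cast hp.ne'
  unfold startClocks clocks ratVal
  split_ifs
  · rw [Nat.cast_sub (by omega)]
    push_cast
    field_simp
    ring
  · norm_num
  · norm_num
  · norm_num
  · norm_num

theorem primrec_startClocks : Primrec (startClocks hn) := by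
  refine Primrec.fin_curry.2 (Primrec₂.swap (Primrec.fin_curry₁.2 fun x => ?_))
  unfold startClocks
  split_ifs
  · exact (Primrec.nat_add.comp (Primrec.nat_mul.comp (.const 2) .fst) .snd).pair
      (Primrec.nat_sub.comp (Primrec.nat_mul.comp (.const 8) .snd) (.const 1))
  all_goals exact .const _

/-- The input that asks whether the goal can be reached with probability `1 / 2` in the game of an
affine machine started in the control state `c` and with the fraction `p.1 / p.2`. -/
def machineInput (c : M.Ctrl) (p : ℕ × ℕ) : Input n where
  locations := List.ofFn fun l => ((eL.symm l).owner, (eL.symm l).inv hn)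
  edges := List.ofFn fun e => ⟨eL (eE.symm e).src, (eE.symm e).guard hn, (eE.symm e).resets hn,
    eL (eE.symm e).tgt, (eE.symm e).weight⟩
  targets := [(eL .goal : ℕ)]
  startLocation := eL (.ctrl c 0)
  startClocks := startClocks hn p
  timeBound := (5, 0)
  cmp := .eq
  threshold := (1, 1)

/-- The game is fixed once and for all; only the initial clock values vary with the fraction. -/
theorem primrec_machineInput (c : M.Ctrl) : Primrec (machineInput hn eL eE c) := by
  have h : Primrec fun p => inputEquiv n (machineInput hn eL eE c p) :=
    (Primrec.const _).pair <| (Primrec.const _).pair <| (Primrec.const _).pair <|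
      (Primrec.const _).pair <| (primrec_startClocks hn).pair <|
        (Primrec.const (5, 0)).pair <| (Primrec.const Cmp.eq).pair (Primrec.const (1, 1))
  exact (Primrec.of_equiv_symm_iff (inputEquiv n)).2 h

variable {f : Input n → Bool}

theorem Solves.machineInput_eq_true_iff (hf : Solves n 5 f) (c : M.Ctrl) {p : ℕ × ℕ}
    (hp : 0 < p.2) (hp' : (p.1 : ℝ) / p.2 ≤ 1) :
    f (machineInput hn eL eE c p) = true ↔ M.Accepts c ((p.1 : ℝ) / p.2) 0 := by
  set I := machineInput hn eL eE c p with hI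
  -- The length of the coded list equals `m` only propositionally, so the numbering of the locations
  -- is transported.
  let eL' : Loc M ≃ Fin I.locations.length := eL.trans (finCongr List.length_ofFn.symm)
  let eE' : Edge M ≃ Fin I.edges.length := eE.trans (finCongr List.length_ofFn.symm)
  have hv : 0 ≤ (p.1 : ℝ) / p.2 ∧ (p.1 : ℝ) / p.2 ≤ 1 := ⟨by positivity, hp'⟩
  have hG : I.Describes (machineGame hn eL' eE') := by
    have hl (l : Fin I.locations.length) : I.locations.get l =
        ((eL'.symm l).owner, (eL'.symm l).inv hn) := List.get_ofFn _ _
    have he (e : Fin I.edges.length) : I.edges.get e =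
        ⟨eL (eE'.symm e).src, (eE'.symm e).guard hn, (eE'.symm e).resets hn,
          eL (eE'.symm e).tgt, (eE'.symm e).weight⟩ := List.get_ofFn _ _
    exact
      { owner := fun l => by rw [hl]; rfl
        inv := fun l => by rw [hl]; rfl
        src := fun e => by rw [he]; rfl
        guard := fun e => by rw [he]; rfl
        reset := fun e => by rw [he]; rfl
        tgt := fun e => by rw [he]; rfl
        weight := fun e => by rw [he]; rfl
        nonBlocking := machineGame_nonBlocking hn eL' eE'
        uniform := uniformGame_hasUniformDelays }
  have hstart : I.IsStart (phaseState hn eL' c 0 (1 / 8) ((p.1 : ℝ) / p.2) 0) :=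
    ⟨rfl, fun x => (ratVal_startClocks hn hp x).symm⟩
  have hstate : (machineGame hn eL' eE').IsState
      (phaseState hn eL' c 0 (1 / 8) ((p.1 : ℝ) / p.2) 0) := by
    refine (isState_iff hn eL' eE' _ _).2 ⟨clocks_nonneg hn (by norm_num) le_rfl
      (by linarith [hv.1]) (by norm_num) le_rfl, ?_⟩
    rw [Loc.inv, sat_le_iff, clocks_total]
    norm_num
  have htime : ratVal I.timeBound = 5 := by norm_num [hI, machineInput, ratVal]
  have hthr : ratVal I.threshold = 1 / 2 := by norm_num [hI, machineInput, ratVal]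
  have htarget : I.targetSet = {eL' .goal} := by
    ext l
    simp only [Input.targetSet, Set.mem_ofPred_eq, Set.mem_singleton_iff, Fin.ext_iff]
    exact List.mem_singleton
  rw [hf I _ _ hG hstart hstate (by rw [Input.IsQuantitative, hthr]; norm_num) htime, htarget, htime,
    hthr]
  exact diamondWins_iff_accepts hv ⟨le_rfl, zero_le_one⟩ hstate

end Reduction

/-! Fractions that encode lists of tape symbols -/

section Fractions

variable {Γ : Type} [Fintype Γ] [Inhabited Γ]

/-- The effect of a further tape symbol on the fraction that encodes a list. -/
def consFraction (g : Γ) (p : ℕ × ℕ) : ℕ × ℕ := (2 * digit g * p.2 + p.1, base Γ * p.2)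

theorem consFraction_spec {l : List Γ} {p : ℕ × ℕ} (hp : 0 < p.2)
    (h : encodeList l = (p.1 : ℝ) / p.2) (g : Γ) : 0 < (consFraction g p).2 ∧
      encodeList (g :: l) = ((consFraction g p).1 : ℝ) / (consFraction g p).2 := by
  have hp' : (p.2 : ℝ) ≠ 0 := by exact_mod_cast hp.ne'
  have hb := base_pos (Γ := Γ)
  refine ⟨Nat.mul_pos (by exact_mod_cast hb) hp, ?_⟩
  rw [encodeList, h, consFraction]
  push_cast
  field_simp

theorem primrec_consFraction (g : Γ) : Primrec (consFraction g) :=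
  (Primrec.nat_add.comp (Primrec.nat_mul.comp (.const _) .snd) .fst).pair
    (Primrec.nat_mul.comp (.const _) .snd)

theorem encodeList_replicate (s : Γ) (m : ℕ) : 0 < ((consFraction s)^[m] (0, 1)).2 ∧
    encodeList (List.replicate m s) =
      (((consFraction s)^[m] (0, 1)).1 : ℝ) / ((consFraction s)^[m] (0, 1)).2 := by
  induction m with
  | zero => simp [encodeList]
  | succ m ih =>
    rw [Function.iterate_succ_apply', List.replicate_succ]
    exact consFraction_spec ih.1 ih.2 s

end Fractions

/-! ### Conclusion: a solver would decide the halting problem -/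

theorem not_exists_computable_solves {n : ℕ} (hn : 5 ≤ n) :
    ¬ ∃ f : Input n → Bool, Computable f ∧ Solves n 5 f := by
  rintro ⟨f, hf, hsol⟩
  obtain ⟨Γ, Λ, _, _, _, M, S, x₀, x₁, s, hS, hund⟩ := exists_machine_halting_undecidable
  refine hund (ComputablePred.computable_iff.2 ?_)
  have : Nonempty S := ⟨⟨default, hS.1⟩⟩
  let A := tapeMachine S M
  -- The fraction that encodes the tape `x₀ x₁ s ⋯ s`, built from its blank end, is primitive
  -- recursive in `m`.
  let p : ℕ → ℕ × ℕ := fun m => consFraction x₀ (consFraction x₁ ((consFraction s)^[m] (0, 1)))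
  have hp : Primrec p := (primrec_consFraction x₀).comp ((primrec_consFraction x₁).comp
    (Primrec.nat_iterate .id (.const _) ((primrec_consFraction s).comp .snd)))
  let I : ℕ → Input n := fun m =>
    machineInput hn (Finite.equivFin (Loc A)) (Finite.equivFin (Edge A)) (.take ⟨default, hS.1⟩) (p m)
  refine ⟨fun m => f (I m), hf.comp ((primrec_machineInput hn _ _ _).comp hp).to_comp, ?_⟩
  funext m
  have h1 := encodeList_replicate s m
  have h2 := consFraction_spec h1.1 h1.2 x₁
  have h3 := consFraction_spec h2.1 h2.2 x₀
  have h4 := hsol.machineInput_eq_true_iff hn (Finite.equivFin (Loc A)) (Finite.equivFin (Edge A))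
    (.take ⟨default, hS.1⟩) h3.1 (h3.2 ▸ (encodeList_mem _).2)
  rw [← h3.2] at h4
  exact propext ((accepts_take_iff hS _).symm.trans h4.symm)

end StochasticTimedGame

end

theorem theorem3 (n : ℕ) (hn : 5 ≤ n) :
    ¬ ∃ f : StochasticTimedGame.Input n → Bool,
      Computable f ∧ StochasticTimedGame.Solves n 5 f :=
  StochasticTimedGame.not_exists_computable_solves hn
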